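/- Let $m,n\ge 1$ and let $G\subset[m]\times[\bar n]$ be the edge set of a connected subgraph of the complete bipartite graph $K_{m,n}$ (connected on the full vertex set $[m]\sqcup[\bar n]$). Let $f_G=(f_{ij})$ be the $m\times n$ matrix whose entry $f_{ij}$ is an indeterminate for $(i,\bar j)\in G$ (distinct indeterminates for distinct edges) and $f_{ij}=0$ otherwise. For $I\subset[m]$, $J\subset[\bar n]$ with $|I|=|J|$ let $\Delta_{I,J}(f_G)$ be the minor of $f_G$ with row set $I$ and column set $J$, and let $$N_G:=\operatorname{Newton}\Big(\prod_{(I,J):\,|I|=|J|,\ \Delta_{I,J}(f_G)\neq 0}\Delta_{I,J}(f_G)\Big)\subset\mathbb{R}^G$$ be the Newton polytope (the convex hull of the exponent vectors) of the product of all nonzero minors of $f_G$. Let $Q_G\subset\mathbb{R}^{m+n}$ be the root polytope of $G$, that is, the convex hull of the points $e_i-e_{\bar j}$, $(i,\bar j)\in G$. For a triangulation $\tau$ of $Q_G$ with vertices among these points, let $\varphi_\tau\in\mathbb{R}^G$ be the vector whose coordinate at $(i,\bar j)$ is the sum of the volumes of the top-dimensional simplices of $\tau$ that have $e_i-e_{\bar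 j}$ as a vertex; the secondary polytope of $Q_G$ is the convex hull in $\mathbb{R}^G$ of the vectors $\varphi_\tau$ over all such triangulations $\tau$. Then $N_G$ and the secondary polytope of $Q_G$ have the same normal fan. In particular, the two polytopes are combinatorially equivalent (their face lattices are isomorphic). -/

import Mathlib

open scoped MeasureTheory

noncomputable section

namespace RootPolytope

/-! ### Normal fans and combinatorial equivalence of polytopes -/

section Fans

variable {V : Type*} [AddCommGroup V] [Module ℝ V] [TopologicalSpace V]

/-- The (outer) normal cone of `P` along `F`: all linear functionals whose maximum over `P` is
attained at every point of `F`. -/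
def normalCone (P F : Set V) : Set (StrongDual ℝ V) :=
  {l | F ⊆ l.toExposed P}

/-- The (outer) normal fan of a polytope `P`: the collection of the normal cones of its nonempty
faces. (The faces of a polytope are exactly its exposed faces.) -/
def normalFan (P : Set V) : Set (Set (StrongDual ℝ V)) :=
  {C | ∃ F : Set V, F.Nonempty ∧ IsExposed ℝ P F ∧ C = normalCone P F}

/-- The face lattice of a polytope: its faces, the empty face included, ordered by inclusion. -/
abbrev FaceLattice (P : Set V) : Type _ :=
  {F : Set V // IsExposed ℝ P F}

/-- Two polytopes are combinatorially equivalent if their face lattices are isomorphic. -/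
def CombinatoriallyEquivalent {W : Type*} [AddCommGroup W] [Module ℝ W] [TopologicalSpace W]
    (P : Set V) (Q : Set W) : Prop :=
  Nonempty (FaceLattice P ≃o FaceLattice Q)

end Fans

/-! ### Secondary polytopes -/

section Secondary

variable {ι E : Type*} [Fintype ι] [NormedAddCommGroup E] [InnerProductSpace ℝ E]
  [MeasurableSpace E] [BorelSpace E]

/-- The dimension of the convex hull of a point configuration `A`. -/
def configDim (A : ι → E) : ℕ :=
  Module.finrank ℝ (vectorSpan ℝ (Set.range A))

/-- `K` is a triangulation of the convex hull of the point configuration `A` all of whose simplices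
have their vertices in `A`. -/
def IsTriangulation (A : ι → E) (K : Geometry.SimplicialComplex ℝ E) : Prop :=
  (∀ s ∈ K.faces, (s : Set E) ⊆ Set.range A) ∧ K.space = convexHull ℝ (Set.range A)

open Classical in
/-- The characteristic (Gelfand-Kapranov-Zelevinsky) vector of a triangulation `K` of an injective
point configuration `A`: its `i`-th coordinate is the sum of the volumes of the top-dimensional
simplices of `K` that have `A i` as a vertex. The volume is the Euclidean one on the affine span
of `A`. -/
def gkzVector (A : ι → E) (K : Geometry.SimplicialComplex ℝ E) : ι → ℝ := fun i =>
  ∑ s ∈ (Finset.univ.image A).powerset with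
      s ∈ K.faces ∧ s.card = configDim A + 1 ∧ A i ∈ s,
    (μHE[configDim A] (convexHull ℝ (s : Set E))).toReal

/-- The secondary polytope of (the convex hull of) a point configuration `A`: the convex hull of
the characteristic vectors of all its triangulations. -/
def secondaryPolytope (A : ι → E) : Set (ι → ℝ) :=
  convexHull ℝ {v | ∃ K, IsTriangulation A K ∧ v = gkzVector A K}

end Secondary

/-! ### Newton polytopes and minors -/

/-- The Newton polytope of a polynomial: the convex hull of the exponent vectors of the monomials
that occur in it. -/
def newtonPolytope {σ R : Type*} [CommSemiring R] (p : MvPolynomial σ R) : Set (σ → ℝ) :=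
  convexHull ℝ ((fun (a : σ →₀ ℕ) (s : σ) => (a s : ℝ)) '' (p.support : Set (σ →₀ ℕ)))

/-- The minor of `M` with row set `I` and column set `J`. -/
def minor {R : Type*} [CommRing R] {m n : ℕ} (M : Matrix (Fin m) (Fin n) R)
    (I : Finset (Fin m)) (J : Finset (Fin n)) (h : I.card = J.card) : R :=
  (M.submatrix (I.orderEmbOfFin rfl) (J.orderEmbOfFin h.symm)).det

/-! ### Subgraphs of the complete bipartite graph, given by their sets of edges -/

section Graphs

variable {m n : ℕ}

/-- The graph on the vertex set `[m] ⊔ [n]` with edge set `G`. -/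
def toGraph (G : Finset (Fin m × Fin n)) : SimpleGraph (Fin m ⊕ Fin n) :=
  SimpleGraph.fromRel fun a b => ∃ e ∈ G, a = Sum.inl e.1 ∧ b = Sum.inr e.2

/-- The points `e_i - e_j̄`, one for each edge of `G`, whose convex hull is the root polytope. -/
def rootPoints (G : Finset (Fin m × Fin n)) (e : G) : EuclideanSpace ℝ (Fin m ⊕ Fin n) :=
  EuclideanSpace.single (Sum.inl e.1.1) 1 - EuclideanSpace.single (Sum.inr e.1.2) 1

/-- The generic matrix supported on `G`: its entries are distinct indeterminates at the edges
of `G`, and zero elsewhere. -/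
def genericMatrix (G : Finset (Fin m × Fin n)) : Matrix (Fin m) (Fin n) (MvPolynomial G ℤ) :=
  Matrix.of fun i j => if h : (i, j) ∈ G then MvPolynomial.X ⟨(i, j), h⟩ else 0

open Classical in
/-- The product of all nonzero minors (of all sizes) of the generic matrix supported on `G`. -/
def minorProduct (G : Finset (Fin m × Fin n)) : MvPolynomial G ℤ :=
  ∏ p : {p : Finset (Fin m) × Finset (Fin n) // p.1.card = p.2.card} with
      minor (genericMatrix G) p.1.1 p.1.2 p.2 ≠ 0,
    minor (genericMatrix G) p.1.1 p.1.2 p.2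

/-- The polytope `N_G`. -/
def minorNewtonPolytope (G : Finset (Fin m × Fin n)) : Set (G → ℝ) :=
  newtonPolytope (minorProduct G)

end Graphs

end RootPolytope

end

noncomputable section

namespace RootPolytope

/-! ### Normal fans of convex hulls of finite sets -/

section FanComparison

variable {V : Type*} [AddCommGroup V] [Module ℝ V] [TopologicalSpace V]

/-! The normal fan of a polytope is determined by the relation "`l` and `l'` attain their maxima at
a common point": the face of `l` lies in the face of `l'` iff, for some ε > 0, `l - ε • l'` and `l'`
have a common maximizer (`toExposed_subset_toExposed_iff`). So it suffices to show that both
polytopes induce the same relation; each is turned into a condition on a pair of edge weights ω, ω'.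

Secondary polytope: ω paired with the characteristic vector of a triangulation is, up to the factor
d + 1, the integral of the piecewise affine interpolation of ω. It is maximal iff the interpolation
is the upper concave envelope, that is, iff all convex weights on a top simplex are optimal. Hence ω
and ω' share a maximizing triangulation iff every point of the root polytope has convex weights
optimal for both (`exists_triangulation_max_max_iff`).

Newton polytope: a product has a common maximal exponent iff each factor has one
(`exists_common_isMaxExponent_prod_iff`), and the exponents of a minor are exactly the perfect
matchings of its rows and columns (`mem_support_minor_iff`). So the relation says that every
matchable pair (I, J) has a matching maximal for both weights.

The two conditions agree (`forall_exists_isOptimal_iff`). Given common optimal weights, apply them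
to the point of a normalized matching; by Birkhoff's theorem their support contains a matching, and
it is maximal for both. Conversely, let w be optimal for ω + ω', and let u be ω-optimal at the same
point and ℓ¹-closest to w. If w ≠ u, then w - u contains two alternating matchings f and g of the
same sets. A matching maximal for both weights forces f and g to have equal ω-weight, so trading g
for f in u keeps it optimal and brings it closer to w, a contradiction. -/

/-- Two functionals attain their maxima over `P` at a common point. -/
def CommonMax (P : Set V) (l l' : StrongDual ℝ V) : Prop :=
  (l.toExposed P ∩ l'.toExposed P).Nonempty

theorem le_of_mem_convexHull {X : Set V} {l : StrongDual ℝ V} {c : ℝ} (h : ∀ x ∈ X, l x ≤ c)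
    {y : V} (hy : y ∈ convexHull ℝ X) : l y ≤ c := by
  have : convexHull ℝ X ⊆ {y | l y ≤ c} :=
    convexHull_min h (convex_halfSpace_le l.toLinearMap.isLinear c)
  exact this hy

theorem mem_toExposed_convexHull {X : Set V} {l : StrongDual ℝ V} {x : V} (hx : x ∈ X)
    (h : ∀ y ∈ X, l y ≤ l x) : x ∈ l.toExposed (convexHull ℝ X) :=
  ⟨subset_convexHull ℝ X hx, fun _ hy => le_of_mem_convexHull h hy⟩

theorem exists_mem_toExposed_convexHull {X : Set V} (hf : X.Finite) (hX : X.Nonempty)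
    (l : StrongDual ℝ V) : ∃ x ∈ X, x ∈ l.toExposed (convexHull ℝ X) := by
  obtain ⟨x, hx, h⟩ := Set.exists_max_image X l hf hX
  exact ⟨x, hx, mem_toExposed_convexHull hx h⟩

/-- A generator maximizing `l + l'` does the job: a common maximizer shows that the maximum of the
sum is the sum of the maxima, so both summands must be maximal there. -/
theorem commonMax_convexHull_iff {X : Set V} (hf : X.Finite) (l l' : StrongDual ℝ V) :
    CommonMax (convexHull ℝ X) l l' ↔
      ∃ x ∈ X, (∀ y ∈ X, l y ≤ l x) ∧ ∀ y ∈ X, l' y ≤ l' x := by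
  constructor
  · rintro ⟨v, ⟨hv, h1⟩, -, h2⟩
    have hX : X.Nonempty := convexHull_nonempty_iff.1 ⟨v, hv⟩
    obtain ⟨x, hx, h⟩ := exists_mem_toExposed_convexHull hf hX (l + l')
    have h3 := h.2 v hv
    have h4 := h1 x h.1
    have h5 := h2 x h.1
    simp only [add_apply] at h3
    refine ⟨x, hx, fun y hy => ?_, fun y hy => ?_⟩
    · have := h1 y (subset_convexHull ℝ X hy); linarith
    · have := h2 y (subset_convexHull ℝ X hy); linarith
  · rintro ⟨x, hx, h1, h2⟩
    exact ⟨x, mem_toExposed_convexHull hx h1, mem_toExposed_convexHull hx h2⟩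

/-- If the face of `l` lies in that of `l'`, then `l'` is constant on it, and for small ε
subtracting `ε • l'` does not make any of the finitely many other generators overtake it.
Conversely, `l` is the sum of `l - ε • l'` and `ε • l'`, so a maximizer of `l` maximizes both
summands once they have a common maximizer. -/
theorem toExposed_subset_toExposed_iff [IsTopologicalAddGroup V] [ContinuousSMul ℝ V]
    {X : Set V} (hf : X.Finite) (hX : X.Nonempty)
    (l l' : StrongDual ℝ V) :
    l.toExposed (convexHull ℝ X) ⊆ l'.toExposed (convexHull ℝ X) ↔
      ∃ ε : ℝ, 0 < ε ∧ CommonMax (convexHull ℝ X) (l - ε • l') l' := by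
  constructor
  · intro h
    obtain ⟨v, hvX, hv⟩ := exists_mem_toExposed_convexHull hf hX l
    have hv' := h hv
    have key : ∀ᶠ ε : ℝ in nhdsWithin 0 (Set.Ioi 0), ∀ x ∈ X,
        l x - ε * l' x ≤ l v - ε * l' v := by
      refine (Filter.eventually_all_finite hf).2 fun x hx => ?_
      have hxP := subset_convexHull ℝ X hx
      rcases (hv.2 x hxP).eq_or_lt with he | hlt
      · have hx' : x ∈ l'.toExposed (convexHull ℝ X) := h ⟨hxP, fun y hy => he ▸ hv.2 y hy⟩
        have : l' x = l' v := le_antisymm (hv'.2 x hxP) (hx'.2 v hv.1)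
        simp [he, this]
      · have hc : Filter.Tendsto (fun ε : ℝ => (l v - ε * l' v) - (l x - ε * l' x))
            (nhdsWithin 0 (Set.Ioi 0)) (nhds ((l v - 0 * l' v) - (l x - 0 * l' x))) :=
          (Continuous.tendsto (by fun_prop) 0).mono_left nhdsWithin_le_nhds
        have := hc.eventually (lt_mem_nhds (show (0 : ℝ) < _ by linarith))
        filter_upwards [this] with ε h
        linarith
    obtain ⟨ε, hε, hε0⟩ := (key.and self_mem_nhdsWithin).exists
    refine ⟨ε, hε0, v, mem_toExposed_convexHull hvX fun y hy => ?_, hv'⟩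
    simpa using hε y hy
  · rintro ⟨ε, hε, v, hv, hv'⟩ y hy
    refine ⟨hy.1, fun z hz => (hv'.2 z hz).trans ?_⟩
    have h1 := hv.2 y hy.1
    have h2 := hy.2 v hv.1
    simp only [sub_apply, smul_apply, smul_eq_mul] at h1
    have : ε * l' v ≤ ε * l' y := by linarith
    exact le_of_mul_le_mul_left this hε

theorem normalFan_eq_range {X : Set V} (hf : X.Finite) (hX : X.Nonempty) :
    normalFan (convexHull ℝ X) = Set.range fun l : StrongDual ℝ V =>
      {l' | l.toExposed (convexHull ℝ X) ⊆ l'.toExposed (convexHull ℝ X)} := by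
  ext C
  constructor
  · rintro ⟨F, hne, hF, rfl⟩
    obtain ⟨l, rfl⟩ := hF hne
    exact ⟨l, rfl⟩
  · rintro ⟨l, rfl⟩
    obtain ⟨x, -, hx⟩ := exists_mem_toExposed_convexHull hf hX l
    exact ⟨_, ⟨x, hx⟩, ContinuousLinearMap.toExposed.isExposed, rfl⟩

/-- The face of `P'` that is exposed by the functionals exposing the face `F` of `P`. -/
def transferFace (P P' F : Set V) : Set V :=
  {y | ∃ l : StrongDual ℝ V, F.Nonempty ∧ F = l.toExposed P ∧ y ∈ l.toExposed P'}

theorem transferFace_empty (P P' : Set V) : transferFace P P' ∅ = ∅ := by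
  simp [transferFace]

/-- Functionals exposing the same face of `P` have mutually contained, hence equal, faces on `P'`;
the choice of functional is immaterial. -/
theorem transferFace_toExposed {P P' : Set V} {l : StrongDual ℝ V}
    (hl : (l.toExposed P).Nonempty)
    (h : ∀ l l' : StrongDual ℝ V, l.toExposed P ⊆ l'.toExposed P ↔
      l.toExposed P' ⊆ l'.toExposed P') :
    transferFace P P' (l.toExposed P) = l.toExposed P' := by
  ext y
  constructor
  · rintro ⟨l', -, he, hy⟩
    exact (h l' l).1 he.ge hy
  · exact fun hy => ⟨l, hl, rfl, hy⟩

theorem isExposed_transferFace {P P' F : Set V} (hF : IsExposed ℝ P F)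
    (h : ∀ l l' : StrongDual ℝ V, l.toExposed P ⊆ l'.toExposed P ↔
      l.toExposed P' ⊆ l'.toExposed P') : IsExposed ℝ P' (transferFace P P' F) := by
  rcases F.eq_empty_or_nonempty with rfl | hne
  · rw [transferFace_empty]; exact isExposed_empty
  · obtain ⟨l, rfl⟩ := hF hne
    exact (transferFace_toExposed hne h).symm ▸ ContinuousLinearMap.toExposed.isExposed

theorem transferFace_mono {P P' F F' : Set V} (hF : IsExposed ℝ P F) (hF' : IsExposed ℝ P F')
    (h : ∀ l l' : StrongDual ℝ V, l.toExposed P ⊆ l'.toExposed P ↔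
      l.toExposed P' ⊆ l'.toExposed P') (hle : F ⊆ F') :
    transferFace P P' F ⊆ transferFace P P' F' := by
  rcases F.eq_empty_or_nonempty with rfl | hne
  · rw [transferFace_empty]; exact Set.empty_subset _
  · obtain ⟨l, rfl⟩ := hF hne
    obtain ⟨l', rfl⟩ := hF' (hne.mono hle)
    have := (h l l').1 hle
    rwa [← transferFace_toExposed hne h, ← transferFace_toExposed (hne.mono hle) h] at this

theorem transferFace_transferFace {P P' F : Set V} (hF : IsExposed ℝ P F)
    (hne' : ∀ l : StrongDual ℝ V, (l.toExposed P').Nonempty)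
    (h : ∀ l l' : StrongDual ℝ V, l.toExposed P ⊆ l'.toExposed P ↔
      l.toExposed P' ⊆ l'.toExposed P') : transferFace P' P (transferFace P P' F) = F := by
  rcases F.eq_empty_or_nonempty with rfl | hne
  · rw [transferFace_empty, transferFace_empty]
  · obtain ⟨l, rfl⟩ := hF hne
    have := transferFace_toExposed (hne' l) fun l l' => (h l l').symm
    rwa [← transferFace_toExposed hne h] at this

theorem normalFan_eq_and_combinatoriallyEquivalent [IsTopologicalAddGroup V] [ContinuousSMul ℝ V]
    {X X' : Set V} (hf : X.Finite)
    (hX : X.Nonempty) (hf' : X'.Finite) (hX' : X'.Nonempty)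
    (h : ∀ l l' : StrongDual ℝ V,
      CommonMax (convexHull ℝ X) l l' ↔ CommonMax (convexHull ℝ X') l l') :
    normalFan (convexHull ℝ X) = normalFan (convexHull ℝ X') ∧
      CombinatoriallyEquivalent (convexHull ℝ X) (convexHull ℝ X') := by
  have key : ∀ l l' : StrongDual ℝ V,
      l.toExposed (convexHull ℝ X) ⊆ l'.toExposed (convexHull ℝ X) ↔
        l.toExposed (convexHull ℝ X') ⊆ l'.toExposed (convexHull ℝ X') := fun l l' => by
    simp_rw [toExposed_subset_toExposed_iff hf hX, toExposed_subset_toExposed_iff hf' hX', h]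
  have hne : ∀ l : StrongDual ℝ V, (l.toExposed (convexHull ℝ X)).Nonempty := fun l =>
    (exists_mem_toExposed_convexHull hf hX l).imp fun _ => And.right
  have hne' : ∀ l : StrongDual ℝ V, (l.toExposed (convexHull ℝ X')).Nonempty := fun l =>
    (exists_mem_toExposed_convexHull hf' hX' l).imp fun _ => And.right
  have key' := fun l l' => (key l l').symm
  refine ⟨?_, ⟨⟨⟨fun F => ⟨_, isExposed_transferFace F.2 key⟩,
    fun F => ⟨_, isExposed_transferFace F.2 key'⟩,
    fun F => Subtype.ext (transferFace_transferFace F.2 hne' key),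
    fun F => Subtype.ext (transferFace_transferFace F.2 hne key')⟩, ?_⟩⟩⟩
  · rw [normalFan_eq_range hf hX, normalFan_eq_range hf' hX']
    simp_rw [key]
  · intro F F'
    refine ⟨fun hle => ?_, fun hle => transferFace_mono F.2 F'.2 key hle⟩
    have := transferFace_mono (isExposed_transferFace F.2 key) (isExposed_transferFace F'.2 key)
      key' hle
    rwa [transferFace_transferFace F.2 hne' key, transferFace_transferFace F'.2 hne' key] at this

end FanComparison

/-! ### Optimal convex weights on a point configuration -/

section OptimalWeights

variable {ι E : Type*} [Fintype ι] [NormedAddCommGroup E] [InnerProductSpace ℝ E]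

/-- The point with the weights `w` on the configuration `A`. -/
abbrev comb (A : ι → E) : (ι → ℝ) →ₗ[ℝ] E :=
  Fintype.linearCombination ℝ A

/-- The convex weights `w` maximize `ω ⬝ᵥ w` among all convex weights of the same point. -/
def IsOptimal (A : ι → E) (ω w : ι → ℝ) : Prop :=
  w ∈ stdSimplex ℝ ι ∧ ∀ w' ∈ stdSimplex ℝ ι, comb A w' = comb A w → ω ⬝ᵥ w' ≤ ω ⬝ᵥ w

/-- All convex weights supported on `T` are optimal. -/
def IsOptimalFace (A : ι → E) (ω : ι → ℝ) (T : Finset ι) : Prop :=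
  ∀ w ∈ stdSimplex ℝ ι, (∀ i ∉ T, w i = 0) → IsOptimal A ω w

variable {A : ι → E} {ω w : ι → ℝ}

theorem mem_convexHull_image_iff {T : Set ι} {x : E} :
    x ∈ convexHull ℝ (A '' T) ↔
      ∃ w ∈ stdSimplex ℝ ι, (∀ i ∉ T, w i = 0) ∧ comb A w = x := by
  classical
  constructor
  · intro hx
    have hc : Convex ℝ (comb A '' {w | w ∈ stdSimplex ℝ ι ∧ ∀ i ∉ T, w i = 0}) := by
      refine Convex.linear_image (𝕜 := ℝ) ?_ _
      refine fun w hw w' hw' a b ha hb hab =>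
        ⟨convex_stdSimplex ℝ ι hw.1 hw'.1 ha hb hab, fun i hi => ?_⟩
      simp [hw.2 i hi, hw'.2 i hi]
    have hsub : A '' T ⊆ comb A '' {w | w ∈ stdSimplex ℝ ι ∧ ∀ i ∉ T, w i = 0} := by
      rintro _ ⟨i, hi, rfl⟩
      refine ⟨Pi.single i 1, ⟨single_mem_stdSimplex ℝ i, fun j hj => ?_⟩, by simp⟩
      exact Pi.single_eq_of_ne (by rintro rfl; exact hj hi) _
    obtain ⟨w, hw, rfl⟩ := convexHull_min hsub hc hx
    exact ⟨w, hw.1, hw.2, rfl⟩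
  · rintro ⟨w, hw, h0, rfl⟩
    have hs : ∑ i with i ∈ T, w i = 1 := by
      rw [← hw.2, Finset.sum_filter]
      exact Finset.sum_congr rfl fun i _ => by split_ifs with h <;> simp [h0, h]
    have hc : comb A w = ∑ i with i ∈ T, w i • A i := by
      rw [Finset.sum_filter, Fintype.linearCombination_apply]
      exact Finset.sum_congr rfl fun i _ => by split_ifs with h <;> simp [h0, h]
    rw [hc]
    refine (convex_convexHull ℝ _).sum_mem (fun i _ => hw.1 i) hs fun i hi => ?_
    exact subset_convexHull ℝ _ ⟨i, (Finset.mem_filter.1 hi).2, rfl⟩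

theorem mem_convexHull_range_iff {x : E} :
    x ∈ convexHull ℝ (Set.range A) ↔ ∃ w ∈ stdSimplex ℝ ι, comb A w = x := by
  rw [← Set.image_univ, mem_convexHull_image_iff]
  simp

theorem exists_pos_mul_le {a w : ι → ℝ} (hw : ∀ i, 0 ≤ w i) (h : ∀ i, w i = 0 → a i = 0) :
    ∃ ε : ℝ, 0 < ε ∧ ∀ i, ε * a i ≤ w i := by
  have key : ∀ᶠ ε : ℝ in nhdsWithin 0 (Set.Ioi 0), ∀ i, ε * a i ≤ w i := by
    refine Filter.eventually_all.2 fun i => ?_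
    rcases (hw i).eq_or_lt with he | hlt
    · simp [h i he.symm, ← he]
    · have hc : Filter.Tendsto (fun ε : ℝ => ε * a i)
          (nhdsWithin 0 (Set.Ioi 0)) (nhds (0 * a i)) :=
        (Continuous.tendsto (by fun_prop) 0).mono_left nhdsWithin_le_nhds
      exact (hc.eventually (gt_mem_nhds (by simpa using hlt))).mono fun _ => le_of_lt
  obtain ⟨ε, hε, hε0⟩ := (key.and self_mem_nhdsWithin).exists
  exact ⟨ε, hε0, hε⟩

theorem add_smul_sub_mem_stdSimplex {a b : ι → ℝ} {ε : ℝ} (hw : w ∈ stdSimplex ℝ ι) (hε : 0 ≤ ε)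
    (hle : ∀ i, ε * a i ≤ w i) (hb : ∀ i, 0 ≤ b i) (hs : ∑ i, b i = ∑ i, a i) :
    w + ε • (b - a) ∈ stdSimplex ℝ ι := by
  refine ⟨fun i => ?_, ?_⟩
  · have := mul_nonneg hε (hb i)
    have := hle i
    simp only [Pi.add_apply, Pi.smul_apply, Pi.sub_apply, smul_eq_mul]
    linarith
  · simp [Finset.sum_add_distrib, ← Finset.mul_sum, hs, hw.2]

/-- No exchange of weights within the support of optimal weights is an improvement. -/
theorem IsOptimal.dotProduct_le (h : IsOptimal A ω w) {a b : ι → ℝ} (hb : ∀ i, 0 ≤ b i)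
    (hs : ∑ i, b i = ∑ i, a i) (hc : comb A b = comb A a) (h0 : ∀ i, w i = 0 → a i = 0) :
    ω ⬝ᵥ b ≤ ω ⬝ᵥ a := by
  obtain ⟨ε, hε, hle⟩ := exists_pos_mul_le h.1.1 h0
  have := h.2 _ (add_smul_sub_mem_stdSimplex h.1 hε.le hle hb hs) (by simp [hc])
  rw [dotProduct_add, dotProduct_smul, dotProduct_sub, smul_eq_mul] at this
  by_contra! hlt
  have := mul_pos hε (sub_pos.2 hlt)
  linarith

/-- Optimality depends on the support only and is inherited by smaller supports: an improvement of
`w'` would be an exchange available at `w` as well. -/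
theorem IsOptimal.of_support_subset (h : IsOptimal A ω w) {w' : ι → ℝ}
    (hw' : w' ∈ stdSimplex ℝ ι) (h0 : ∀ i, w i = 0 → w' i = 0) : IsOptimal A ω w' :=
  ⟨hw', fun _ hw'' hc => h.dotProduct_le hw''.1 (hw''.2.trans hw'.2.symm) hc h0⟩

theorem exists_isOptimal (ω : ι → ℝ) (hw : w ∈ stdSimplex ℝ ι) :
    ∃ w', IsOptimal A ω w' ∧ comb A w' = comb A w := by
  have hcl : IsClosed (comb A ⁻¹' {comb A w}) :=
    isClosed_singleton.preimage (comb A).continuous_of_finiteDimensional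
  obtain ⟨w', hw', hmax⟩ := ((isCompact_stdSimplex ℝ ι).inter_right hcl).exists_isMaxOn
    ⟨w, hw, rfl⟩ (f := fun u => ω ⬝ᵥ u) (Continuous.continuousOn (by unfold dotProduct; fun_prop))
  exact ⟨w', ⟨hw'.1, fun u hu hc => hmax ⟨hu, hc.trans hw'.2⟩⟩, hw'.2⟩

/-- The witness `w'` shows that the optimum for the sum is the sum of the optima, so every optimum
for the sum is optimal for each term. -/
theorem IsOptimal.both_of_add {ω' w' : ι → ℝ} (h : IsOptimal A (ω + ω') w)
    (h1 : IsOptimal A ω w') (h2 : IsOptimal A ω' w') (hc : comb A w = comb A w') :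
    IsOptimal A ω w ∧ IsOptimal A ω' w := by
  have h3 := h.2 w' h1.1 hc.symm
  have h4 := h1.2 w h.1 hc
  have h5 := h2.2 w h.1 hc
  rw [add_dotProduct, add_dotProduct] at h3
  refine ⟨⟨h.1, fun u hu hu' => ?_⟩, ⟨h.1, fun u hu hu' => ?_⟩⟩
  · have := h1.2 u hu (hu'.trans hc); linarith
  · have := h2.2 u hu (hu'.trans hc); linarith

theorem sum_coe_eq_sum {M : Type*} [AddCommMonoid M] {T : Finset ι} {f : ι → M}
    (hf : ∀ i ∉ T, f i = 0) : ∑ i : T, f i = ∑ i, f i := by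
  rw [Finset.sum_coe_sort T f]
  exact Finset.sum_subset (Finset.subset_univ T) fun i _ hi => hf i hi

theorem affineIndependent_coe_iff {T : Finset ι} :
    AffineIndependent ℝ (fun i : T => A i) ↔
      ∀ κ : ι → ℝ, (∀ i ∉ T, κ i = 0) → ∑ i, κ i = 0 → comb A κ = 0 → κ = 0 := by
  classical
  rw [affineIndependent_iff_of_fintype]
  have hvsub : ∀ u : T → ℝ, ∑ i, u i = 0 →
      (Finset.univ.weightedVSub (fun i : T => A i)) u = ∑ i, u i • A i := fun u hu => by
    rw [Finset.weightedVSub_eq_weightedVSubOfPoint_of_sum_eq_zero _ _ _ hu 0]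
    simp
  constructor
  · intro h κ h0 hs hc
    have hs' : ∑ i : T, κ i = 0 := by rw [sum_coe_eq_sum h0, hs]
    have := h (fun i => κ i) hs' (by
      rw [hvsub _ hs', sum_coe_eq_sum (f := fun i => κ i • A i) fun i hi => by simp [h0 i hi], ← hc]
      simp [Fintype.linearCombination_apply])
    funext i
    by_cases hi : i ∈ T
    · exact this ⟨i, hi⟩
    · exact h0 i hi
  · intro h u hs hc i
    rw [hvsub u hs] at hc
    set κ : ι → ℝ := fun i => if h : i ∈ T then u ⟨i, h⟩ else 0 with hκ
    have hκT : ∀ i : T, κ i = u i := fun i => by simp [hκ]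
    have h0 : ∀ i ∉ T, κ i = 0 := fun i hi => by simp [hκ, hi]
    have := h κ h0 (by rw [← sum_coe_eq_sum h0]; simpa [hκT] using hs) (by
      rw [Fintype.linearCombination_apply,
        ← sum_coe_eq_sum (T := T) (f := fun i => κ i • A i) fun i hi => by simp [h0 i hi]]
      simpa [hκT] using hc)
    rw [← hκT, this, Pi.zero_apply]

theorem IsOptimal.isOptimalFace_support (h : IsOptimal A ω w) :
    IsOptimalFace A ω {i | w i ≠ 0} :=
  fun _ hw' h0 => h.of_support_subset hw' fun i hi => h0 i (by simpa using hi)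

theorem IsOptimalFace.mono {T T' : Finset ι} (h : IsOptimalFace A ω T) (hT : T' ⊆ T) :
    IsOptimalFace A ω T' :=
  fun w hw h0 => h w hw fun i hi => h0 i fun hi' => hi (hT hi')

/-- There are convex weights with support `T`. -/
theorem exists_stdSimplex_support_eq {T : Finset ι} (hT : T.Nonempty) :
    ∃ w ∈ stdSimplex ℝ ι, ∀ i, w i = 0 ↔ i ∉ T := by
  classical
  have hc : (T.card : ℝ) ≠ 0 := by exact_mod_cast hT.card_pos.ne'
  refine ⟨fun i => if i ∈ T then (T.card : ℝ)⁻¹ else 0, ⟨fun i => ?_, ?_⟩, fun i => ?_⟩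
  · dsimp only
    split_ifs <;> positivity
  · simp [hc]
  · simp [hT.ne_empty]

/-- The positive and negative parts of an affine dependence are weights of the same point and mass,
both supported in `T`, so neither exchange can improve. -/
theorem IsOptimalFace.dotProduct_eq_zero {T : Finset ι} (h : IsOptimalFace A ω T) {κ : ι → ℝ}
    (h0 : ∀ i ∉ T, κ i = 0) (hs : ∑ i, κ i = 0) (hc : comb A κ = 0) : ω ⬝ᵥ κ = 0 := by
  rcases T.eq_empty_or_nonempty with rfl | hT
  · have : κ = 0 := funext fun i => h0 i (Finset.notMem_empty i)
    simp [this]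
  obtain ⟨w, hw, hw0⟩ := exists_stdSimplex_support_eq hT
  have hopt := h w hw fun i hi => (hw0 i).2 hi
  have hκ : κ = κ⁺ - κ⁻ := (posPart_sub_negPart κ).symm
  have hs' : ∑ i, κ⁺ i = ∑ i, κ⁻ i := by
    rw [← sub_eq_zero, ← Finset.sum_sub_distrib, ← hs]
    exact Finset.sum_congr rfl fun i _ => (congrFun hκ i).symm
  have hc' : comb A κ⁺ = comb A κ⁻ := by rw [← sub_eq_zero, ← map_sub, ← hκ, hc]
  have h1 := hopt.dotProduct_le (a := κ⁻) (b := κ⁺) (posPart_nonneg κ) hs' hc' fun i hi => by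
    simp [negPart, h0 i ((hw0 i).1 hi)]
  have h2 := hopt.dotProduct_le (a := κ⁺) (b := κ⁻) (negPart_nonneg κ) hs'.symm hc'.symm
    fun i hi => by simp [posPart, h0 i ((hw0 i).1 hi)]
  rw [hκ, dotProduct_sub]
  linarith

/-- A small generic perturbation of `θ` has affinely independent optimal faces, all of which are
optimal for `θ`. -/
theorem exists_generic (A : ι → E) (θ : ι → ℝ) : ∃ ψ : ι → ℝ, ∀ T, IsOptimalFace A ψ T →
    IsOptimalFace A θ T ∧ AffineIndependent ℝ (fun i : T => A i) := by
  classical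
  have hbad : ∀ T : {T : Finset ι // ¬ AffineIndependent ℝ (fun i : T => A i)},
      ∃ κ : ι → ℝ, (∀ i ∉ T.1, κ i = 0) ∧ ∑ i, κ i = 0 ∧ comb A κ = 0 ∧ κ ≠ 0 := by
    rintro ⟨T, hT⟩
    rw [affineIndependent_coe_iff] at hT
    push Not at hT
    exact hT
  choose κ hκ0 hκs hκc hκ using hbad
  -- One affine dependence is chosen per dependent set; a direction ρ outside finitely many
  -- hyperplanes pairs nontrivially with all of them.
  obtain ⟨f, hf⟩ := Module.exists_dual_forall_apply_ne_zero (K := ℝ) κ hκ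
  set ρ : ι → ℝ := fun i => f (Pi.single i 1) with hρ
  have hρf : ∀ v, ρ ⬝ᵥ v = f v := fun v => by
    rw [LinearMap.pi_apply_eq_sum_univ f v]
    simp only [dotProduct, hρ, smul_eq_mul, mul_comm]
    exact Finset.sum_congr rfl fun i _ => by
      congr 2; funext j; simp [Pi.single_apply, eq_comm]
  have h1 : ∀ᶠ ε : ℝ in nhdsWithin 0 (Set.Ioi 0), ∀ T, (θ + ε • ρ) ⬝ᵥ κ T ≠ 0 := by
    refine Filter.eventually_all.2 fun T => ?_
    have hne : ∀ᶠ ε : ℝ in nhdsWithin 0 (Set.Ioi 0), ε ≠ -(θ ⬝ᵥ κ T) / (ρ ⬝ᵥ κ T) := by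
      by_cases hc : -(θ ⬝ᵥ κ T) / (ρ ⬝ᵥ κ T) = 0
      · rw [hc]
        filter_upwards [self_mem_nhdsWithin] with ε hε using ne_of_gt hε
      · exact nhdsWithin_le_nhds (isOpen_ne.mem_nhds (Ne.symm hc))
    filter_upwards [hne] with ε hε h
    rw [add_dotProduct, smul_dotProduct, smul_eq_mul] at h
    have hT : ρ ⬝ᵥ κ T ≠ 0 := by rw [hρf]; exact hf T
    exact hε ((eq_div_iff hT).2 (by linarith))
  -- A strict improvement witnessing non-optimality for θ survives small perturbations, and there
  -- are only finitely many sets `T`.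
  have h2 : ∀ᶠ ε : ℝ in nhdsWithin 0 (Set.Ioi 0), ∀ T, ¬ IsOptimalFace A θ T →
      ¬ IsOptimalFace A (θ + ε • ρ) T := by
    refine Filter.eventually_all.2 fun T => ?_
    by_cases hT : IsOptimalFace A θ T
    · simp [hT]
    have hT' := hT
    simp only [IsOptimalFace, IsOptimal] at hT'
    push Not at hT'
    obtain ⟨w, hw, hw0, h⟩ := hT'
    obtain ⟨w', hw', hc, hlt⟩ := h hw
    have ht : Filter.Tendsto (fun ε : ℝ => (θ ⬝ᵥ w' + ε * ρ ⬝ᵥ w') - (θ ⬝ᵥ w + ε * ρ ⬝ᵥ w))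
        (nhdsWithin 0 (Set.Ioi 0))
        (nhds ((θ ⬝ᵥ w' + 0 * ρ ⬝ᵥ w') - (θ ⬝ᵥ w + 0 * ρ ⬝ᵥ w))) :=
      (Continuous.tendsto (by fun_prop) 0).mono_left nhdsWithin_le_nhds
    filter_upwards [ht.eventually (lt_mem_nhds (show (0 : ℝ) < _ by linarith))] with ε hε _ hopt
    have := (hopt w hw hw0).2 w' hw' hc
    simp only [add_dotProduct, smul_dotProduct, smul_eq_mul] at this
    linarith
  obtain ⟨ε, h1, h2⟩ := (h1.and h2).exists
  refine ⟨θ + ε • ρ, fun T hT => ⟨by_contra fun h => h2 T h hT, by_contra fun h => ?_⟩⟩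
  exact h1 ⟨T, h⟩ (hT.dotProduct_eq_zero (hκ0 ⟨T, h⟩) (hκs ⟨T, h⟩) (hκc ⟨T, h⟩))

/-- The midpoint of two optimal weights of one point is again optimal, and its support contains both
supports; affine independence there leaves only one set of weights. -/
theorem IsOptimal.eq_of_generic (hω : ∀ T, IsOptimalFace A ω T →
    AffineIndependent ℝ (fun i : T => A i)) (h : IsOptimal A ω w) {w' : ι → ℝ}
    (h' : IsOptimal A ω w') (hc : comb A w = comb A w') : w = w' := by
  have hval : ω ⬝ᵥ w = ω ⬝ᵥ w' := le_antisymm (h'.2 w h.1 hc) (h.2 w' h'.1 hc.symm)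
  set u : ι → ℝ := (1 / 2 : ℝ) • w + (1 / 2 : ℝ) • w' with hu
  have huc : comb A u = comb A w := by
    rw [hu, map_add, map_smul, map_smul, ← hc, ← add_smul]; norm_num
  have huo : IsOptimal A ω u := by
    refine ⟨convex_stdSimplex ℝ ι h.1 h'.1 (by norm_num) (by norm_num) (by norm_num),
      fun v hv hv' => ?_⟩
    have := h.2 v hv (hv'.trans huc)
    rw [hu, dotProduct_add, dotProduct_smul, dotProduct_smul, ← hval, smul_eq_mul]
    linarith
  have hind := affineIndependent_coe_iff.1 (hω _ huo.isOptimalFace_support)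
  rw [← sub_eq_zero]
  refine hind _ (fun i hi => ?_) ?_ (by rw [map_sub, hc, sub_self])
  · have hui : u i = 0 := by simpa using hi
    have h1 := h.1.1 i
    have h2 := h'.1.1 i
    simp only [hu, Pi.add_apply, Pi.smul_apply, smul_eq_mul] at hui
    rw [Pi.sub_apply]
    linarith
  · simp [h.1.2, h'.1.2]

end OptimalWeights

/-! ### Regular triangulations -/

section RegularTriangulation

variable {ι E : Type*} [Fintype ι] [NormedAddCommGroup E] [InnerProductSpace ℝ E] {A : ι → E}

/-- Every linear functional on the weights has a triangulation by optimal faces. -/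
theorem exists_triangulation_isOptimalFace (hA : Function.Injective A) (θ : ι → ℝ) :
    ∃ K, IsTriangulation A K ∧ ∀ T : Finset ι, T.map ⟨A, hA⟩ ∈ K.faces → IsOptimalFace A θ T := by
  classical
  obtain ⟨ψ, hψ⟩ := exists_generic A θ
  have huniq : ∀ {w w'}, IsOptimal A ψ w → IsOptimal A ψ w' → comb A w = comb A w' → w = w' :=
    fun h h' hc => h.eq_of_generic (fun T hT => (hψ T hT).2) h' hc
  let K : Geometry.SimplicialComplex ℝ E :=
    -- The optimal faces of the generic perturbation ψ, with the empty face erased. They are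
    -- affinely independent by genericity.
    Geometry.SimplicialComplex.ofErase
      {s | ∃ T : Finset ι, s = T.map ⟨A, hA⟩ ∧ IsOptimalFace A ψ T}
      (by
        rintro _ ⟨T, rfl, hT⟩
        refine (hψ T hT).2.range.mono ?_
        intro x hx
        obtain ⟨i, hi, rfl⟩ := Finset.mem_map.1 (Finset.mem_coe.1 hx)
        exact ⟨⟨i, hi⟩, rfl⟩)
      (by
        rintro _ t hts ⟨T, rfl, hT⟩
        refine ⟨T.filter (A · ∈ t), ?_, hT.mono (Finset.filter_subset _ _)⟩
        ext x
        simp only [Finset.mem_map, Finset.mem_filter, Function.Embedding.coeFn_mk]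
        refine ⟨fun hx => ?_, ?_⟩
        · obtain ⟨i, hi, rfl⟩ := Finset.mem_map.1 (hts hx)
          exact ⟨i, ⟨hi, hx⟩, rfl⟩
        · rintro ⟨i, ⟨-, h⟩, rfl⟩
          exact h)
      (by
        rintro _ ⟨T, rfl, hT⟩ _ ⟨T', rfl, hT'⟩ x ⟨hx, hx'⟩
        simp only [Finset.coe_map, Function.Embedding.coeFn_mk, mem_convexHull_image_iff] at hx hx'
        obtain ⟨w, hw, h0, rfl⟩ := hx
        obtain ⟨w', hw', h0', hc⟩ := hx'
        -- A point in two simplices has unique optimal weights, so these are supported on the common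
        -- vertices.
        obtain rfl := huniq (hT w hw h0) (hT' w' hw' h0') hc.symm
        simp only [Finset.coe_map, Function.Embedding.coeFn_mk]
        rw [← Set.image_inter hA, mem_convexHull_image_iff]
        refine ⟨w, hw, fun i hi => ?_, rfl⟩
        by_contra hwi
        exact hi ⟨by_contra fun h => hwi (h0 i h), by_contra fun h => hwi (h0' i h)⟩)
  refine ⟨K, ⟨?_, ?_⟩, ?_⟩
  · rintro _ ⟨⟨T, rfl, -⟩, -⟩ x hx
    obtain ⟨i, -, rfl⟩ := Finset.mem_map.1 (Finset.mem_coe.1 hx)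
    exact ⟨i, rfl⟩
  · ext x
    rw [Geometry.SimplicialComplex.mem_space_iff]
    constructor
    · rintro ⟨_, ⟨⟨T, rfl, -⟩, -⟩, hx⟩
      refine convexHull_mono ?_ hx
      rw [Finset.coe_map]
      exact Set.image_subset_range _ _
    · rw [mem_convexHull_range_iff]
      rintro ⟨w, hw, rfl⟩
      obtain ⟨w', hw', hc⟩ := exists_isOptimal (A := A) ψ hw
      have hx : comb A w ∈ convexHull ℝ
          ((Finset.map ⟨A, hA⟩ ({i | w' i ≠ 0} : Finset ι) : Finset E) : Set E) := by
        rw [Finset.coe_map]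
        exact mem_convexHull_image_iff.2 ⟨w', hw'.1, fun i hi => by simpa using hi, hc⟩
      refine ⟨_, ⟨⟨_, rfl, hw'.isOptimalFace_support⟩, fun h => ?_⟩, hx⟩
      rw [Set.mem_singleton_iff.1 h] at hx
      simp at hx
  · rintro T ⟨⟨T', hTT', hT'⟩, -⟩
    obtain rfl := Finset.map_injective _ hTT'
    exact (hψ T hT').1

end RegularTriangulation

open MeasureTheory

/-! ### Integrals of affine functions over simplices -/

section SimplexIntegral

variable {κ V : Type*} [Fintype κ] [NormedAddCommGroup V] [NormedSpace ℝ V]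

theorem coord_add_smul_sub (b : AffineBasis κ ℝ V) [DecidableEq κ] (i j k : κ) (x : V)
    (c : ℝ) : b.coord k (x + c • (b i - b j)) =
      b.coord k x + c * ((if k = i then 1 else 0) - if k = j then 1 else 0) := by
  have h1 : (b.coord k).linear (b i - b j) =
      (if k = i then 1 else 0) - if k = j then 1 else 0 := by
    have := (b.coord k).linearMap_vsub (b i) (b j)
    simpa [AffineBasis.coord_apply] using this
  have h2 := (b.coord k).map_vadd x (c • (b i - b j))
  rw [vadd_eq_add, vadd_eq_add, map_smul, h1, smul_eq_mul] at h2
  rw [add_comm x, h2, add_comm]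

theorem isCompact_nonneg_coord (b : AffineBasis κ ℝ V) :
    IsCompact {x | ∀ k, 0 ≤ b.coord k x} := by
  rw [← b.convexHull_eq_nonneg_coord]
  exact (Set.finite_range b).isCompact_convexHull ℝ

variable [FiniteDimensional ℝ V] [MeasurableSpace V] [BorelSpace V]

theorem measurePreserving_reflection (μ : Measure V) [μ.IsAddHaarMeasure] {f : Module.Dual ℝ V}
    {v : V} (h : f v = 2) : MeasurePreserving (Module.reflection h) μ μ := by
  have hdet : LinearMap.det (Module.reflection h : V →ₗ[ℝ] V) *
      LinearMap.det (Module.reflection h : V →ₗ[ℝ] V) = 1 := by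
    rw [← LinearMap.det_comp]
    have : (Module.reflection h : V →ₗ[ℝ] V) ∘ₗ (Module.reflection h : V →ₗ[ℝ] V) =
        LinearMap.id := LinearMap.ext fun x => Module.involutive_reflection h x
    rw [this, LinearMap.det_id]
  have hne : LinearMap.det (Module.reflection h : V →ₗ[ℝ] V) ≠ 0 := left_ne_zero_of_mul_eq_one hdet
  refine ⟨((Module.reflection h : V →ₗ[ℝ] V).continuous_of_finiteDimensional).measurable, ?_⟩
  have := Measure.map_linearMap_addHaar_eq_smul_addHaar μ hne
  have habs : |(LinearMap.det (Module.reflection h : V →ₗ[ℝ] V))⁻¹| = 1 := by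
    rcases mul_self_eq_one_iff.1 hdet with h | h <;> simp [h]
  rw [habs, ENNReal.ofReal_one, one_smul] at this
  exact this

/-- The affine involution exchanging the vertices `i` and `j` is a linear reflection followed by a
translation. It preserves Haar measure and the simplex, and swaps the two barycentric coordinates.
-/
theorem setIntegral_coord_eq (b : AffineBasis κ ℝ V) (μ : Measure V) [μ.IsAddHaarMeasure]
    (i j : κ) : ∫ x in {x | ∀ k, 0 ≤ b.coord k x}, b.coord i x ∂μ =
      ∫ x in {x | ∀ k, 0 ≤ b.coord k x}, b.coord j x ∂μ := by
  classical
  rcases eq_or_ne i j with rfl | hij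
  · rfl
  set f : Module.Dual ℝ V := (b.coord i).linear - (b.coord j).linear with hf
  have hfx : ∀ x, f x = b.coord i x - b.coord j x - (b.coord i 0 - b.coord j 0) := fun x => by
    have h1 := (b.coord i).linearMap_vsub x 0
    have h2 := (b.coord j).linearMap_vsub x 0
    simp only [vsub_eq_sub, sub_zero] at h1 h2
    rw [hf, LinearMap.sub_apply, h1, h2]
    ring
  have hfv : f (b i - b j) = 2 := by
    rw [map_sub, hfx, hfx]
    simp [hij, hij.symm]
    norm_num
  set T : V → V := fun x => x + (b.coord j x - b.coord i x) • (b i - b j) with hT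
  have hTeq : T = (fun x => x + (b.coord j 0 - b.coord i 0) • (b i - b j)) ∘
      Module.reflection hfv := by
    funext x
    simp only [hT, Function.comp, Module.reflection_apply, hfx]
    module
  have hmp : MeasurePreserving T μ μ := by
    rw [hTeq]
    exact (measurePreserving_add_right μ _).comp (measurePreserving_reflection μ hfv)
  have hcoord : ∀ x k, b.coord k (T x) = b.coord (Equiv.swap i j k) x := fun x k => by
    rw [hT, coord_add_smul_sub]
    rcases eq_or_ne k i with rfl | hki
    · simp [hij]
    rcases eq_or_ne k j with rfl | hkj
    · simp [hki]
    · simp [hki, hkj, Equiv.swap_apply_of_ne_of_ne hki hkj]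
  have hTT : Function.Involutive T := fun x => by
    refine b.ext_elem fun k => ?_
    rw [hcoord, hcoord, Equiv.swap_apply_self]
  have hcont : Continuous T := by
    have h1 := continuous_barycentric_coord b i
    have h2 := continuous_barycentric_coord b j
    fun_prop
  have hemb : MeasurableEmbedding T :=
    (Homeomorph.mk hTT.toPerm hcont hcont).measurableEmbedding
  have hpre : T ⁻¹' {x | ∀ k, 0 ≤ b.coord k x} = {x | ∀ k, 0 ≤ b.coord k x} := by
    ext x
    simp only [Set.mem_preimage, Set.mem_ofPred_eq, hcoord]
    exact ⟨fun h k => by simpa using h (Equiv.swap i j k), fun h k => h _⟩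
  have := hmp.setIntegral_preimage_emb hemb (b.coord j) {x | ∀ k, 0 ≤ b.coord k x}
  rw [hpre] at this
  rw [← this]
  simp [hcoord]

theorem integrableOn_coord (b : AffineBasis κ ℝ V) (μ : Measure V) [μ.IsAddHaarMeasure]
    (i : κ) : IntegrableOn (b.coord i) {x | ∀ k, 0 ≤ b.coord k x} μ :=
  (continuous_barycentric_coord b i).continuousOn.integrableOn_compact (isCompact_nonneg_coord b)

/-- The integral of a barycentric coordinate over a simplex. -/
theorem setIntegral_coord (b : AffineBasis κ ℝ V) (μ : Measure V) [μ.IsAddHaarMeasure]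
    (i : κ) : ∫ x in {x | ∀ k, 0 ≤ b.coord k x}, b.coord i x ∂μ =
      μ.real {x | ∀ k, 0 ≤ b.coord k x} / Fintype.card κ := by
  have hsum : ∑ j, ∫ x in {x | ∀ k, 0 ≤ b.coord k x}, b.coord j x ∂μ =
      μ.real {x | ∀ k, 0 ≤ b.coord k x} := by
    rw [← integral_finsetSum _ fun j _ => integrableOn_coord b μ j]
    simp
  have hcard : (Fintype.card κ : ℝ) ≠ 0 := by
    have : Nonempty κ := ⟨i⟩
    exact_mod_cast Fintype.card_ne_zero
  rw [eq_div_iff hcard, ← hsum, Finset.sum_congr rfl fun j _ => setIntegral_coord_eq b μ j i]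
  simp [mul_comm]

end SimplexIntegral

/-! ### The Euclidean volume on the affine span of a configuration -/

section ConfigVolume

variable {ι E : Type*} [NormedAddCommGroup E] [InnerProductSpace ℝ E] {A : ι → E}

theorem image_convexHull_image {F : Type*} [NormedAddCommGroup F] [NormedSpace ℝ F]
    {ψ : F →ᵃ[ℝ] E} {B : ι → F} (h : ∀ i, ψ (B i) = A i) (T : Set ι) :
    ψ '' convexHull ℝ (B '' T) = convexHull ℝ (A '' T) := by
  rw [ψ.image_convexHull, Set.image_image]
  simp_rw [h]

theorem convexHull_image_eq_nonneg_coord {F : Type*} [NormedAddCommGroup F] [NormedSpace ℝ F]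
    {T : Finset ι} {B : ι → F} {b : AffineBasis T ℝ F}
    (hb : ∀ i : T, b i = B i) : convexHull ℝ (B '' T) = {x | ∀ k, 0 ≤ b.coord k x} := by
  rw [← b.convexHull_eq_nonneg_coord]
  congr 1
  ext x
  constructor
  · rintro ⟨i, hi, rfl⟩
    exact ⟨⟨i, hi⟩, hb ⟨i, hi⟩⟩
  · rintro ⟨i, rfl⟩
    exact ⟨i, i.2, (hb i).symm⟩

variable [Fintype ι]

/-- Transports questions about Hausdorff measure on the affine span to Lebesgue volume on a
Euclidean space of full dimension. -/
theorem exists_chart [Nonempty ι] (A : ι → E) :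
    ∃ (ψ : vectorSpan ℝ (Set.range A) →ᵃ[ℝ] E) (B : ι → vectorSpan ℝ (Set.range A)),
      (∀ i, ψ (B i) = A i) ∧ Isometry ψ ∧ affineSpan ℝ (Set.range B) = ⊤ := by
  obtain ⟨i₀⟩ := ‹Nonempty ι›
  let W := vectorSpan ℝ (Set.range A)
  let ψ : W →ᵃ[ℝ] E := AffineMap.const ℝ W (A i₀) + W.subtype.toAffineMap
  have hψ : ∀ x, ψ x = A i₀ + x := fun x => rfl
  let B : ι → W := fun i => ⟨A i -ᵥ A i₀, vsub_mem_vectorSpan ℝ ⟨i, rfl⟩ ⟨i₀, rfl⟩⟩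
  have hB : ∀ i, ψ (B i) = A i := fun i => by simp [hψ, B]
  refine ⟨ψ, B, hB, Isometry.of_dist_eq fun x y => by simp [hψ, Subtype.dist_eq], ?_⟩
  have : FiniteDimensional ℝ W := finiteDimensional_vectorSpan_of_finite ℝ (Set.finite_range A)
  rw [AffineSubspace.affineSpan_eq_top_iff_vectorSpan_eq_top_of_nonempty ℝ _ _
    (Set.range_nonempty B)]
  refine Submodule.eq_top_of_finrank_eq ?_
  have hmap : Submodule.map W.subtype (vectorSpan ℝ (Set.range B)) = W := by
    have h1 := ψ.map_vectorSpan (s := Set.range B)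
    have h2 : ψ.linear = W.subtype := by ext x; simp [ψ]
    rw [h2, ← Set.range_comp] at h1
    rw [h1]
    congr 2
    funext i
    exact hB i
  have hrk := (Submodule.equivMapOfInjective W.subtype W.injective_subtype
    (vectorSpan ℝ (Set.range B))).finrank_eq
  rw [hrk, hmap]

instance finiteDimensional_vectorSpan_range (A : ι → E) :
    FiniteDimensional ℝ (vectorSpan ℝ (Set.range A)) :=
  finiteDimensional_vectorSpan_of_finite ℝ (Set.finite_range A)

theorem exists_affineBasis {T : Finset ι} (hT : AffineIndependent ℝ (fun i : T => A i))
    (hc : T.card = configDim A + 1) {ψ : vectorSpan ℝ (Set.range A) →ᵃ[ℝ] E}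
    {B : ι → vectorSpan ℝ (Set.range A)} (hB : ∀ i, ψ (B i) = A i) :
    ∃ b : AffineBasis T ℝ (vectorSpan ℝ (Set.range A)), ∀ i : T, b i = B i := by
  have hind : AffineIndependent ℝ (fun i : T => B i) := by
    refine AffineIndependent.of_comp ψ ?_
    have : ψ ∘ (fun i : T => B i) = fun i : T => A i := funext fun i => hB i
    rwa [this]
  refine ⟨⟨_, hind, ?_⟩, fun i => rfl⟩
  rw [hind.affineSpan_eq_top_iff_card_eq_finrank_add_one, Fintype.card_coe, hc, configDim]

variable [MeasurableSpace E] [BorelSpace E]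

theorem measure_image_chart {W : Submodule ℝ E} [FiniteDimensional ℝ W]
    {ψ : W → E} (hψ : Isometry ψ) (s : Set W) :
    μHE[Module.finrank ℝ W] (ψ '' s) = volume s := by
  rw [hψ.euclideanHausdorffMeasure_image, InnerProductSpace.euclideanHausdorffMeasure_eq_volume]

theorem measure_convexHull_eq_zero {T : Finset ι} (hT : T.card ≤ configDim A) :
    μHE[configDim A] (convexHull ℝ (A '' T)) = 0 := by
  classical
  rcases T.eq_empty_or_nonempty with rfl | hne
  · simp
  have : Nonempty ι := hne.to_type
  obtain ⟨ψ, B, hB, hψ, -⟩ := exists_chart A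
  rw [← image_convexHull_image hB, configDim, measure_image_chart hψ]
  refine measure_mono_null (convexHull_subset_affineSpan _)
    (Measure.addHaar_affineSubspace _ _ fun htop => ?_)
  obtain ⟨k, hk⟩ := Nat.exists_eq_succ_of_ne_zero hne.card_pos.ne'
  have h1 := finrank_vectorSpan_image_finset_le ℝ B T hk
  rw [Finset.coe_image, AffineSubspace.vectorSpan_eq_top_of_affineSpan_eq_top ℝ _ _ htop,
    finrank_top] at h1
  rw [configDim] at hT
  omega

theorem measure_convexHull_pos {T : Finset ι} (hT : AffineIndependent ℝ (fun i : T => A i))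
    (hc : T.card = configDim A + 1) : 0 < μHE[configDim A] (convexHull ℝ (A '' T)) := by
  have hne : T.Nonempty := Finset.card_pos.1 (by omega)
  have : Nonempty ι := hne.to_type
  obtain ⟨ψ, B, hB, hψ, -⟩ := exists_chart A
  obtain ⟨b, hb⟩ := exists_affineBasis hT hc hB
  rw [← image_convexHull_image hB, configDim, measure_image_chart hψ]
  refine Measure.measure_pos_of_nonempty_interior _ ?_
  rw [interior_convexHull_nonempty_iff_affineSpan_eq_top, ← b.tot]
  congr 1
  ext x
  constructor
  · rintro ⟨i, hi, rfl⟩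
    exact ⟨⟨i, hi⟩, hb ⟨i, hi⟩⟩
  · rintro ⟨i, rfl⟩
    exact ⟨i, i.2, (hb i).symm⟩

/-- The affine interpolation of `ω` on a top-dimensional simplex and its integral. -/
theorem exists_interpolation {T : Finset ι} (hT : AffineIndependent ℝ (fun i : T => A i))
    (hc : T.card = configDim A + 1) (ω : ι → ℝ) :
    ∃ g : E → ℝ, (∀ w ∈ stdSimplex ℝ ι, (∀ i ∉ T, w i = 0) → g (comb A w) = ω ⬝ᵥ w) ∧
      IntegrableOn g (convexHull ℝ (A '' T)) μHE[configDim A] ∧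
      ∫ x in convexHull ℝ (A '' T), g x ∂μHE[configDim A] =
        (μHE[configDim A] (convexHull ℝ (A '' T))).toReal / (configDim A + 1 : ℕ) *
          ∑ i ∈ T, ω i := by
  have hne : T.Nonempty := Finset.card_pos.1 (by omega)
  have : Nonempty ι := hne.to_type
  obtain ⟨ψ, B, hB, hψ, -⟩ := exists_chart A
  obtain ⟨b, hb⟩ := exists_affineBasis hT hc hB
  have hemb : MeasurableEmbedding ψ := hψ.isClosedEmbedding.measurableEmbedding
  have hmap : volume.map ψ = (μHE[configDim A]).restrict (Set.range ψ) := by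
    rw [← hψ.map_euclideanHausdorffMeasure, configDim,
      InnerProductSpace.euclideanHausdorffMeasure_eq_volume]
  set h : vectorSpan ℝ (Set.range A) → ℝ := fun x => ∑ i : T, ω i * b.coord i x with hh
  have hhψ : Function.extend ψ h 0 ∘ ψ = h := Function.extend_comp hψ.injective h 0
  have hpre : ψ ⁻¹' convexHull ℝ (A '' T) = {x | ∀ k, 0 ≤ b.coord k x} := by
    rw [← image_convexHull_image hB, Set.preimage_image_eq _ hψ.injective,
      convexHull_image_eq_nonneg_coord hb]
  have hres : (volume.map ψ).restrict (convexHull ℝ (A '' T)) =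
      (μHE[configDim A]).restrict (convexHull ℝ (A '' T)) := by
    rw [hmap, Measure.restrict_restrict_of_subset]
    rw [← image_convexHull_image hB]
    exact Set.image_subset_range _ _
  -- The interpolation is written in barycentric coordinates in the chart and extended by 0 off the
  -- affine span.
  refine ⟨Function.extend ψ h 0, fun w hw h0 => ?_, ?_, ?_⟩
  · have hsum : ∑ i : T, w i = 1 := by rw [sum_coe_eq_sum h0, hw.2]
    have hw' : comb A w = ψ (Finset.univ.affineCombination ℝ b fun i : T => w i) := by
      rw [Finset.map_affineCombination _ _ _ hsum, Finset.affineCombination_eq_linear_combination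
        _ _ _ hsum, Fintype.linearCombination_apply,
        ← sum_coe_eq_sum (T := T) (f := fun i => w i • A i) fun i hi => by simp [h0 i hi]]
      simp [hb, hB]
    rw [hw', hψ.injective.extend_apply, hh, dotProduct,
      ← sum_coe_eq_sum (T := T) (f := fun i => ω i * w i) fun i hi => by simp [h0 i hi]]
    refine Finset.sum_congr rfl fun i _ => ?_
    rw [b.coord_apply_combination_of_mem (Finset.mem_univ i) hsum]
  · rw [IntegrableOn, ← hres, hemb.restrict_map, hemb.integrable_map_iff, hhψ, hpre]
    exact integrable_finsetSum _ fun i _ => (integrableOn_coord b volume i).const_mul _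
  · rw [← hres, hemb.setIntegral_map, hpre]
    have hvol : μHE[configDim A] (convexHull ℝ (A '' T)) =
        volume {x | ∀ k, 0 ≤ b.coord k x} := by
      rw [← image_convexHull_image hB, configDim, measure_image_chart hψ,
        convexHull_image_eq_nonneg_coord hb]
    have : ∀ x, Function.extend ψ h 0 (ψ x) = h x := fun x => congrFun hhψ x
    simp_rw [this, hh]
    rw [integral_finsetSum _ fun i _ => (integrableOn_coord b volume i).const_mul _]
    simp_rw [integral_const_mul, setIntegral_coord]
    rw [← Finset.sum_mul, Finset.sum_coe_sort T ω, hvol, Fintype.card_coe, hc, mul_comm]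
    rfl

/-- A closed set that contains almost all of a polytope contains it. -/
theorem convexHull_range_subset_of_measure_diff_eq_zero {U : Set E} (hU : IsClosed U)
    (h : μHE[configDim A] (convexHull ℝ (Set.range A) \ U) = 0) :
    convexHull ℝ (Set.range A) ⊆ U := by
  rcases isEmpty_or_nonempty ι with hι | hι
  · simp [Set.range_eq_empty]
  obtain ⟨ψ, B, hB, hψ, htop⟩ := exists_chart A
  have himg : ψ '' convexHull ℝ (Set.range B) = convexHull ℝ (Set.range A) := by
    simpa only [Set.image_univ] using image_convexHull_image hB Set.univ
  have hU' : IsClosed (ψ ⁻¹' U) := hU.preimage hψ.continuous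
  have hnull : volume (interior (convexHull ℝ (Set.range B)) \ ψ ⁻¹' U) = 0 := by
    rw [← measure_image_chart hψ]
    refine measure_mono_null ?_ h
    rintro _ ⟨x, ⟨hx, hxU⟩, rfl⟩
    exact ⟨himg ▸ ⟨x, interior_subset hx, rfl⟩, hxU⟩
  -- An open null set is empty, so the closed set contains the interior of the polytope and hence
  -- its closure.
  have hempty := (isOpen_interior.sdiff hU').eq_empty_of_measure_zero hnull
  have hsub : convexHull ℝ (Set.range B) ⊆ ψ ⁻¹' U := by
    have hint : (interior (convexHull ℝ (Set.range B))).Nonempty :=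
      interior_convexHull_nonempty_iff_affineSpan_eq_top.2 htop
    calc convexHull ℝ (Set.range B) ⊆ closure (convexHull ℝ (Set.range B)) := subset_closure
      _ = closure (interior (convexHull ℝ (Set.range B))) :=
        ((convex_convexHull ℝ _).closure_interior_eq_closure_of_nonempty_interior hint).symm
      _ ⊆ ψ ⁻¹' U := closure_minimal (Set.sdiff_eq_empty.1 hempty) hU'
  rw [← himg]
  rintro _ ⟨x, hx, rfl⟩
  exact hsub hx

end ConfigVolume

/-! ### Maximal vertices of the secondary polytope -/

section SecondaryMax

variable {ι E : Type*} [NormedAddCommGroup E] [InnerProductSpace ℝ E] {A : ι → E}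
  {K : Geometry.SimplicialComplex ℝ E} {ω : ι → ℝ}

theorem convexHull_map (hA : Function.Injective A) (T : Finset ι) :
    convexHull ℝ ((T.map ⟨A, hA⟩ : Finset E) : Set E) = convexHull ℝ (A '' T) := by
  rw [Finset.coe_map]; rfl

/-- The points of the simplices on `A` of less than full dimension. -/
def lowerSkeleton (A : ι → E) : Set E :=
  ⋃ T ∈ {T : Finset ι | T.card ≤ configDim A}, convexHull ℝ (A '' T)

theorem mem_lowerSkeleton {T : Finset ι} {x : E} (hx : x ∈ convexHull ℝ (A '' T))
    (hT : T.card ≤ configDim A) : x ∈ lowerSkeleton A :=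
  Set.mem_biUnion (x := T) hT hx

theorem affineIndependent_of_map_mem_faces (hA : Function.Injective A) {T : Finset ι}
    (hT : T.map ⟨A, hA⟩ ∈ K.faces) : AffineIndependent ℝ (fun i : T => A i) :=
  let f : T ↪ T.map ⟨A, hA⟩ := ⟨fun i => ⟨A i, Finset.mem_map.2 ⟨i, i.2, rfl⟩⟩,
    fun _ _ h => Subtype.ext (hA (congrArg Subtype.val h))⟩
  (K.indep hT).comp_embedding f

variable [Fintype ι]

open Classical in
/-- The index sets of the top-dimensional simplices of `K`. -/
def topFaces (hA : Function.Injective A) (K : Geometry.SimplicialComplex ℝ E) :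
    Finset (Finset ι) :=
  {T | T.map ⟨A, hA⟩ ∈ K.faces ∧ T.card = configDim A + 1}

theorem mem_topFaces {hA : Function.Injective A} {T : Finset ι} :
    T ∈ topFaces hA K ↔ T.map ⟨A, hA⟩ ∈ K.faces ∧ T.card = configDim A + 1 := by
  classical
  simp [topFaces]

theorem exists_mem_topFaces (hA : Function.Injective A) (hK : IsTriangulation A K) {x : E}
    (hx : x ∈ convexHull ℝ (Set.range A)) (hxZ : x ∉ lowerSkeleton A) :
    ∃ T ∈ topFaces hA K, x ∈ convexHull ℝ (A '' T) := by
  classical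
  rw [← hK.2, Geometry.SimplicialComplex.mem_space_iff] at hx
  obtain ⟨s, hs, hxs⟩ := hx
  obtain ⟨T, rfl⟩ : ∃ T : Finset ι, s = T.map ⟨A, hA⟩ := by
    refine ⟨Finset.univ.filter (A · ∈ s), Finset.ext fun y => ⟨fun hy => ?_, fun hy => ?_⟩⟩
    · obtain ⟨i, rfl⟩ := hK.1 s hs hy
      exact Finset.mem_map.2 ⟨i, by simpa using hy, rfl⟩
    · obtain ⟨i, hi, rfl⟩ := Finset.mem_map.1 hy
      simpa using hi
  rw [convexHull_map] at hxs
  refine ⟨T, mem_topFaces.2 ⟨hs, le_antisymm ?_ ?_⟩, hxs⟩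
  · have h1 := (affineIndependent_of_map_mem_faces hA hs).card_le_finrank_succ
    rw [Fintype.card_coe] at h1
    refine h1.trans (Nat.succ_le_succ (Submodule.finrank_mono (vectorSpan_mono ℝ ?_)))
    rintro _ ⟨i, rfl⟩
    exact ⟨i, rfl⟩
  · by_contra hlt
    exact hxZ (mem_lowerSkeleton hxs (by omega))

/-- Distinct top simplices meet in a common face with fewer vertices, which lies in the lower
skeleton. -/
theorem eq_of_mem_topFaces {hA : Function.Injective A} {T T' : Finset ι}
    (hT : T ∈ topFaces hA K) (hT' : T' ∈ topFaces hA K) {x : E}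
    (hx : x ∈ convexHull ℝ (A '' T)) (hx' : x ∈ convexHull ℝ (A '' T'))
    (hxZ : x ∉ lowerSkeleton A) : T = T' := by
  classical
  rw [mem_topFaces] at hT hT'
  have h := K.inter_subset_convexHull hT.1 hT'.1 ⟨by rwa [convexHull_map], by rwa [convexHull_map]⟩
  rw [Finset.coe_map, Finset.coe_map, Function.Embedding.coeFn_mk, ← Set.image_inter hA,
    ← Finset.coe_inter] at h
  by_contra hne
  refine hxZ (mem_lowerSkeleton h ?_)
  by_contra hlt
  have h1 : T ∩ T' = T := Finset.eq_of_subset_of_card_le Finset.inter_subset_left (by omega)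
  have h2 : T ∩ T' = T' := Finset.eq_of_subset_of_card_le Finset.inter_subset_right (by omega)
  exact hne (h1.symm.trans h2)

variable [MeasurableSpace E] [BorelSpace E]

/-- The skeleton involves all small index sets, not just faces of one complex, so a single null set
serves every triangulation at once. -/
theorem measure_lowerSkeleton (A : ι → E) : μHE[configDim A] (lowerSkeleton A) = 0 :=
  (measure_biUnion_null_iff (Set.to_countable _)).2 fun _ hT => measure_convexHull_eq_zero hT

open Classical in
theorem gkzVector_apply (hA : Function.Injective A) (i : ι) :
    gkzVector A K i = ∑ T ∈ topFaces hA K with i ∈ T,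
      (μHE[configDim A] (convexHull ℝ (A '' T))).toReal := by
  rw [gkzVector]
  symm
  refine Finset.sum_bij (fun T _ => T.map ⟨A, hA⟩) (fun T hT => ?_)
    (fun T _ T' _ h => Finset.map_injective _ h) (fun s hs => ?_) fun T _ => by rw [convexHull_map]
  · rw [Finset.mem_filter, mem_topFaces] at hT
    simp only [Finset.mem_filter, Finset.mem_powerset, Finset.card_map]
    refine ⟨fun x hx => ?_, hT.1.1, hT.1.2, Finset.mem_map.2 ⟨i, hT.2, rfl⟩⟩
    obtain ⟨j, -, rfl⟩ := Finset.mem_map.1 hx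
    exact Finset.mem_image_of_mem A (Finset.mem_univ j)
  · simp only [Finset.mem_filter, Finset.mem_powerset] at hs
    obtain ⟨hsub, hs1, hs2, hs3⟩ := hs
    have heq : ({j | A j ∈ s} : Finset ι).map ⟨A, hA⟩ = s := by
      refine Finset.ext fun y => ⟨fun hy => ?_, fun hy => ?_⟩
      · obtain ⟨j, hj, rfl⟩ := Finset.mem_map.1 hy
        simpa using hj
      · obtain ⟨j, -, rfl⟩ := Finset.mem_image.1 (hsub hy)
        exact Finset.mem_map.2 ⟨j, by simpa using hy, rfl⟩
    refine ⟨Finset.univ.filter (A · ∈ s), ?_, heq⟩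
    simp only [Finset.mem_filter, mem_topFaces, heq]
    refine ⟨⟨hs1, ?_⟩, Finset.mem_univ i, hs3⟩
    rw [← hs2, ← heq, Finset.card_map, heq]

theorem dotProduct_gkzVector (hA : Function.Injective A) (ω : ι → ℝ) :
    ω ⬝ᵥ gkzVector A K = ∑ T ∈ topFaces hA K,
      (μHE[configDim A] (convexHull ℝ (A '' T))).toReal * ∑ i ∈ T, ω i := by
  classical
  simp_rw [dotProduct, gkzVector_apply hA, Finset.sum_filter, Finset.mul_sum]
  rw [Finset.sum_comm]
  refine Finset.sum_congr rfl fun T _ => ?_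
  rw [← Finset.sum_subset (Finset.subset_univ T) fun i _ hi => by simp [hi]]
  exact Finset.sum_congr rfl fun i hi => by simp [hi, mul_comm]

/-- The piecewise affine interpolation of `ω` on a triangulation. -/
theorem exists_piecewise_interpolation (hA : Function.Injective A)
    (K : Geometry.SimplicialComplex ℝ E) (ω : ι → ℝ) :
    ∃ H : E → ℝ, Integrable H μHE[configDim A] ∧
      ((configDim A + 1 : ℕ) : ℝ) * ∫ x, H x ∂μHE[configDim A] = ω ⬝ᵥ gkzVector A K ∧
      (∀ T ∈ topFaces hA K, ∀ w ∈ stdSimplex ℝ ι, (∀ i ∉ T, w i = 0) →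
        comb A w ∉ lowerSkeleton A → H (comb A w) = ω ⬝ᵥ w) ∧
      ∀ x ∉ convexHull ℝ (Set.range A), H x = 0 := by
  classical
  have hg := fun T : topFaces hA K => exists_interpolation
    (affineIndependent_of_map_mem_faces hA (mem_topFaces.1 T.2).1) (mem_topFaces.1 T.2).2 ω
  choose g hg1 hg2 hg3 using hg
  have hms : ∀ T : Finset ι, MeasurableSet (convexHull ℝ (A '' T)) := fun T =>
    ((T.finite_toSet.image A).isCompact_convexHull ℝ).isClosed.measurableSet
  -- The sum overcounts only where top simplices overlap, which is inside the lower skeleton.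
  refine ⟨fun x => ∑ T : topFaces hA K, (convexHull ℝ (A '' T)).indicator (g T) x,
    integrable_finsetSum _ fun T _ => (hg2 T).integrable_indicator (hms T), ?_, ?_, ?_⟩
  · rw [integral_finsetSum _ fun T _ => (hg2 T).integrable_indicator (hms T)]
    simp_rw [integral_indicator (hms _), hg3]
    rw [dotProduct_gkzVector hA, Finset.mul_sum, ← Finset.sum_coe_sort (topFaces hA K)]
    refine Finset.sum_congr rfl fun T _ => ?_
    have : ((configDim A + 1 : ℕ) : ℝ) ≠ 0 := by positivity
    field_simp
  · intro T hT w hw h0 hZ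
    have hx : comb A w ∈ convexHull ℝ (A '' T) := mem_convexHull_image_iff.2 ⟨w, hw, h0, rfl⟩
    dsimp only
    rw [Finset.sum_eq_single (⟨T, hT⟩ : topFaces hA K), Set.indicator_of_mem hx,
      hg1 ⟨T, hT⟩ w hw h0]
    · intro T' _ hne
      refine Set.indicator_of_notMem (fun hx' => hne (Subtype.ext ?_)) _
      exact eq_of_mem_topFaces T'.2 hT hx' hx hZ
    · simp
  · intro x hx
    refine Finset.sum_eq_zero fun T _ => Set.indicator_of_notMem (fun hx' => hx ?_) _
    exact convexHull_mono (Set.image_subset_range _ _) hx'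

/-- The interpolation on `K₀` is the concave envelope of ω and dominates the one on `K` almost
everywhere; integrating gives the inequality. Equality of integrals forces equality almost
everywhere, hence at some point of each top simplex of `K` off the lower skeleton. There the weights
have full support, so their optimality spreads to the whole simplex. -/
theorem dotProduct_gkzVector_le_of_isOptimalFace (hA : Function.Injective A) (hK : IsTriangulation A K)
    {K₀ : Geometry.SimplicialComplex ℝ E} (hK₀ : IsTriangulation A K₀)
    (hopt : ∀ T ∈ topFaces hA K₀, IsOptimalFace A ω T) :
    ω ⬝ᵥ gkzVector A K ≤ ω ⬝ᵥ gkzVector A K₀ ∧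
      (ω ⬝ᵥ gkzVector A K = ω ⬝ᵥ gkzVector A K₀ → ∀ T ∈ topFaces hA K, IsOptimalFace A ω T) := by
  obtain ⟨H, hHi, hHs, hHv, hH0⟩ := exists_piecewise_interpolation hA K ω
  obtain ⟨H', hHi', hHs', hHv', hH0'⟩ := exists_piecewise_interpolation hA K₀ ω
  have hZ : ∀ᵐ x ∂μHE[configDim A], x ∉ lowerSkeleton A :=
    compl_mem_ae_iff.2 (measure_lowerSkeleton A)
  have hd : (0 : ℝ) < ((configDim A + 1 : ℕ) : ℝ) := by positivity
  have hle : H ≤ᵐ[μHE[configDim A]] H' := by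
    filter_upwards [hZ] with x hx
    by_cases hxQ : x ∈ convexHull ℝ (Set.range A)
    · obtain ⟨T, hT, hxT⟩ := exists_mem_topFaces hA hK hxQ hx
      obtain ⟨T', hT', hxT'⟩ := exists_mem_topFaces hA hK₀ hxQ hx
      obtain ⟨w, hw, h0, hwx⟩ := mem_convexHull_image_iff.1 hxT
      obtain ⟨w', hw', h0', rfl⟩ := mem_convexHull_image_iff.1 hxT'
      rw [hHv' T' hT' w' hw' h0' hx, ← hwx, hHv T hT w hw h0 (hwx ▸ hx)]
      exact (hopt T' hT' w' hw' h0').2 w hw hwx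
    · rw [hH0 x hxQ, hH0' x hxQ]
  rw [← hHs, ← hHs']
  refine ⟨mul_le_mul_of_nonneg_left (integral_mono_ae hHi hHi' hle) hd.le, fun heq T hT => ?_⟩
  have hae := (integral_eq_iff_of_ae_le hHi hHi' hle).1 (mul_left_cancel₀ hd.ne' heq)
  have hTm := mem_topFaces.1 hT
  have hpos := measure_convexHull_pos (affineIndependent_of_map_mem_faces hA hTm.1) hTm.2
  obtain ⟨x, hxT, hxZ, hxe⟩ : ∃ x ∈ convexHull ℝ (A '' T), x ∉ lowerSkeleton A ∧ H x = H' x := by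
    by_contra! hcon
    have hnull : μHE[configDim A] {x | ¬ (x ∉ lowerSkeleton A ∧ H x = H' x)} = 0 :=
      ae_iff.1 (hZ.and hae)
    refine hpos.ne' (measure_mono_null (fun x hx => ?_) hnull)
    exact fun h => hcon x hx h.1 h.2
  obtain ⟨w, hw, h0, rfl⟩ := mem_convexHull_image_iff.1 hxT
  have hxQ : comb A w ∈ convexHull ℝ (Set.range A) := mem_convexHull_range_iff.2 ⟨w, hw, rfl⟩
  obtain ⟨T', hT', hxT'⟩ := exists_mem_topFaces hA hK₀ hxQ hxZ
  obtain ⟨w', hw', h0', hc⟩ := mem_convexHull_image_iff.1 hxT'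
  have ho' := hopt T' hT' w' hw' h0'
  rw [hHv T hT w hw h0 hxZ, ← hc, hHv' T' hT' w' hw' h0' (by rwa [hc])] at hxe
  have ho : IsOptimal A ω w :=
    ⟨hw, fun u hu hu' => hxe ▸ ho'.2 u hu (hu'.trans hc.symm)⟩
  intro u hu hu0
  refine ho.of_support_subset hu fun i hi => hu0 i fun hiT => ?_
  classical
  -- A vanishing weight at a vertex would put the point on a facet, inside the lower skeleton.
  refine hxZ (mem_lowerSkeleton (T := T.erase i) (mem_convexHull_image_iff.2
    ⟨w, hw, fun j hj => ?_, rfl⟩) (by rw [Finset.card_erase_of_mem hiT, hTm.2]; omega))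
  rcases eq_or_ne j i with rfl | hne
  · exact hi
  · exact h0 j fun hjT => hj (by simp [hne, hjT])

theorem convexHull_subset_topFaces (hA : Function.Injective A) (hK : IsTriangulation A K) {x : E}
    (hx : x ∈ convexHull ℝ (Set.range A)) : ∃ T ∈ topFaces hA K, x ∈ convexHull ℝ (A '' T) := by
  have hcl : IsClosed (⋃ T ∈ topFaces hA K, convexHull ℝ (A '' T)) :=
    isClosed_biUnion_finset fun T _ =>
      ((T.finite_toSet.image A).isCompact_convexHull ℝ).isClosed
  have := convexHull_range_subset_of_measure_diff_eq_zero hcl (A := A) (by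
    refine measure_mono_null (fun y hy => ?_) (measure_lowerSkeleton A)
    by_contra hyZ
    obtain ⟨T, hT, hyT⟩ := exists_mem_topFaces hA hK hy.1 hyZ
    exact hy.2 (Set.mem_biUnion hT hyT))
  simpa using this hx

/-- A triangulation has a maximal characteristic vector exactly if its simplices are optimal. -/
theorem forall_dotProduct_gkzVector_le_iff (hA : Function.Injective A)
    (hK : IsTriangulation A K) (ω : ι → ℝ) :
    (∀ K', IsTriangulation A K' → ω ⬝ᵥ gkzVector A K' ≤ ω ⬝ᵥ gkzVector A K) ↔
      ∀ T ∈ topFaces hA K, IsOptimalFace A ω T := by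
  constructor
  · intro h
    obtain ⟨K₀, hK₀, hopt⟩ := exists_triangulation_isOptimalFace hA ω
    have := dotProduct_gkzVector_le_of_isOptimalFace hA hK hK₀ fun T hT => hopt T (mem_topFaces.1 hT).1
    exact this.2 (le_antisymm this.1 (h K₀ hK₀))
  · exact fun h K' hK' => (dotProduct_gkzVector_le_of_isOptimalFace hA hK' hK h).1

/-- A common maximal triangulation represents every point on a simplex optimal for both weights.
Conversely, a triangulation by optimal faces for ω + ω' is maximal for both, since pointwise common
optima make the optimum of the sum split. -/
theorem exists_triangulation_max_max_iff (hA : Function.Injective A) (ω ω' : ι → ℝ) :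
    (∃ K, IsTriangulation A K ∧
      (∀ K', IsTriangulation A K' → ω ⬝ᵥ gkzVector A K' ≤ ω ⬝ᵥ gkzVector A K) ∧
      ∀ K', IsTriangulation A K' → ω' ⬝ᵥ gkzVector A K' ≤ ω' ⬝ᵥ gkzVector A K) ↔
    ∀ v ∈ stdSimplex ℝ ι, ∃ w, comb A w = comb A v ∧ IsOptimal A ω w ∧ IsOptimal A ω' w := by
  constructor
  · rintro ⟨K, hK, h1, h2⟩ v hv
    rw [forall_dotProduct_gkzVector_le_iff hA hK] at h1 h2
    obtain ⟨T, hT, hx⟩ := convexHull_subset_topFaces hA hK (mem_convexHull_range_iff.2 ⟨v, hv, rfl⟩)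
    obtain ⟨w, hw, h0, hc⟩ := mem_convexHull_image_iff.1 hx
    exact ⟨w, hc, h1 T hT w hw h0, h2 T hT w hw h0⟩
  · intro h
    obtain ⟨K, hK, hopt⟩ := exists_triangulation_isOptimalFace hA (ω + ω')
    have hboth : ∀ T ∈ topFaces hA K, ∀ w ∈ stdSimplex ℝ ι, (∀ i ∉ T, w i = 0) →
        IsOptimal A ω w ∧ IsOptimal A ω' w := fun T hT w hw h0 => by
      obtain ⟨u, hc, h1, h2⟩ := h w hw
      exact (hopt T (mem_topFaces.1 hT).1 w hw h0).both_of_add h1 h2 hc.symm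
    refine ⟨K, hK, ?_, ?_⟩ <;> rw [forall_dotProduct_gkzVector_le_iff hA hK]
    · exact fun T hT w hw h0 => (hboth T hT w hw h0).1
    · exact fun T hT w hw h0 => (hboth T hT w hw h0).2

/-- The vector depends only on which finite subsets of the configuration are faces. -/
theorem finite_gkzVectors (A : ι → E) :
    {v | ∃ K, IsTriangulation A K ∧ v = gkzVector A K}.Finite := by
  classical
  let F : Finset (Finset E) → ι → ℝ := fun S i =>
    ∑ s ∈ S with s.card = configDim A + 1 ∧ A i ∈ s,
      (μHE[configDim A] (convexHull ℝ (s : Set E))).toReal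
  refine (((Finset.univ.image A).powerset.powerset.finite_toSet).image F).subset ?_
  rintro _ ⟨K, -, rfl⟩
  refine ⟨(Finset.univ.image A).powerset.filter (· ∈ K.faces), ?_, ?_⟩
  · exact Finset.mem_coe.2 (Finset.mem_powerset.2 (Finset.filter_subset _ _))
  · funext i
    simp only [F, gkzVector, Finset.filter_filter]

end SecondaryMax

/-- The coefficient vector of a linear functional. -/
def dualVec {ι : Type*} [DecidableEq ι] (l : StrongDual ℝ (ι → ℝ)) : ι → ℝ :=
  fun i => l (Pi.single i 1)

theorem dualVec_dotProduct {ι : Type*} [DecidableEq ι] [Fintype ι] (l : StrongDual ℝ (ι → ℝ))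
    (v : ι → ℝ) : dualVec l ⬝ᵥ v = l v := by
  have h := LinearMap.pi_apply_eq_sum_univ l.toLinearMap v
  simp only [ContinuousLinearMap.coe_coe] at h
  rw [h, dotProduct]
  refine Finset.sum_congr rfl fun i _ => ?_
  rw [dualVec, smul_eq_mul, mul_comm]
  congr 2
  funext j
  simp [Pi.single_apply, eq_comm]

theorem commonMax_secondaryPolytope_iff {ι E : Type*} [DecidableEq ι] [Fintype ι]
    [NormedAddCommGroup E] [InnerProductSpace ℝ E] [MeasurableSpace E] [BorelSpace E] {A : ι → E}
    (hA : Function.Injective A) (l l' : StrongDual ℝ (ι → ℝ)) :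
    CommonMax (secondaryPolytope A) l l' ↔ ∀ v ∈ stdSimplex ℝ ι,
      ∃ w, comb A w = comb A v ∧ IsOptimal A (dualVec l) w ∧ IsOptimal A (dualVec l') w := by
  rw [← exists_triangulation_max_max_iff hA, secondaryPolytope,
    commonMax_convexHull_iff (finite_gkzVectors A)]
  simp_rw [dualVec_dotProduct]
  constructor
  · rintro ⟨_, ⟨K, hK, rfl⟩, h1, h2⟩
    exact ⟨K, hK, fun K' hK' => h1 _ ⟨K', hK', rfl⟩, fun K' hK' => h2 _ ⟨K', hK', rfl⟩⟩
  · rintro ⟨K, hK, h1, h2⟩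
    refine ⟨_, ⟨K, hK, rfl⟩, ?_, ?_⟩
    · rintro _ ⟨K', hK', rfl⟩; exact h1 K' hK'
    · rintro _ ⟨K', hK', rfl⟩; exact h2 K' hK'

/-! ### Newton polytopes of products -/

section NewtonProduct

variable {σ R : Type*} [CommRing R] {ω ω' : σ → ℝ} {p q : MvPolynomial σ R}
  {a b : σ →₀ ℕ}

/-- `a` is an exponent vector of `p` of maximal `ω`-weight. -/
def IsMaxExponent (ω : σ → ℝ) (p : MvPolynomial σ R) (a : σ →₀ ℕ) : Prop :=
  a ∈ p.support ∧ ∀ b ∈ p.support, Finsupp.weight ω b ≤ Finsupp.weight ω a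

theorem exists_isMaxExponent (ω : σ → ℝ) (hp : p ≠ 0) : ∃ a, IsMaxExponent ω p a :=
  p.support.exists_max_image _ (MvPolynomial.support_nonempty.2 hp)

theorem weight_add_weights (a : σ →₀ ℕ) :
    Finsupp.weight (ω + ω') a = Finsupp.weight ω a + Finsupp.weight ω' a := by
  simp [Finsupp.weight_apply, Finsupp.sum, Finset.sum_add_distrib]

theorem weight_eq_dotProduct [Fintype σ] (ω : σ → ℝ) (a : σ →₀ ℕ) :
    Finsupp.weight ω a = ω ⬝ᵥ fun s => (a s : ℝ) := by
  rw [Finsupp.weight_apply, Finsupp.sum_fintype _ _ (by simp), dotProduct]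
  simp [mul_comm]

theorem weightedHomogeneousComponent_ne_zero (h : IsMaxExponent ω p a) :
    MvPolynomial.weightedHomogeneousComponent ω (Finsupp.weight ω a) p ≠ 0 := by
  intro h0
  have := congrArg (MvPolynomial.coeff a) h0
  rw [MvPolynomial.coeff_weightedHomogeneousComponent, if_pos rfl] at this
  exact MvPolynomial.mem_support_iff.1 h.1 this

/-- The top ω-homogeneous part of a product is the product of the top parts, which is nonzero over a
domain; any monomial of it serves. -/
theorem IsMaxExponent.exists_mul [IsDomain R] (ha : IsMaxExponent ω p a)
    (hb : IsMaxExponent ω q b) :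
    ∃ c, IsMaxExponent ω (p * q) c ∧
      Finsupp.weight ω c = Finsupp.weight ω a + Finsupp.weight ω b := by
  classical
  set P := MvPolynomial.weightedHomogeneousComponent ω (Finsupp.weight ω a) p with hP
  set Q := MvPolynomial.weightedHomogeneousComponent ω (Finsupp.weight ω b) q with hQ
  obtain ⟨c, hc⟩ := MvPolynomial.ne_zero_iff.1 (mul_ne_zero
    (weightedHomogeneousComponent_ne_zero ha) (weightedHomogeneousComponent_ne_zero hb))
  have hcw : Finsupp.weight ω c = Finsupp.weight ω a + Finsupp.weight ω b :=
    ((MvPolynomial.weightedHomogeneousComponent_isWeightedHomogeneous _ p).mul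
      (MvPolynomial.weightedHomogeneousComponent_isWeightedHomogeneous _ q)) hc
  have hcoeff : MvPolynomial.coeff c (p * q) = MvPolynomial.coeff c (P * Q) := by
    rw [MvPolynomial.coeff_mul, MvPolynomial.coeff_mul]
    refine Finset.sum_congr rfl fun x hx => ?_
    have hxw : Finsupp.weight ω x.1 + Finsupp.weight ω x.2 =
        Finsupp.weight ω a + Finsupp.weight ω b := by
      rw [← map_add, Finset.HasAntidiagonal.mem_antidiagonal.1 hx, hcw]
    rw [hP, hQ, MvPolynomial.coeff_weightedHomogeneousComponent,
      MvPolynomial.coeff_weightedHomogeneousComponent]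
    by_cases h1 : MvPolynomial.coeff x.1 p = 0
    · simp [h1]
    by_cases h2 : MvPolynomial.coeff x.2 q = 0
    · simp [h2]
    have h3 := ha.2 _ (MvPolynomial.mem_support_iff.2 h1)
    have h4 := hb.2 _ (MvPolynomial.mem_support_iff.2 h2)
    rw [if_pos (by linarith), if_pos (by linarith)]
  refine ⟨c, ⟨MvPolynomial.mem_support_iff.2 (hcoeff ▸ hc), fun d hd => ?_⟩, hcw⟩
  obtain ⟨x, hx, y, hy, rfl⟩ := Finset.mem_add.1 (MvPolynomial.support_mul p q hd)
  rw [map_add, hcw]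
  exact add_le_add (ha.2 x hx) (hb.2 y hy)

theorem exists_isMaxExponent_prod [IsDomain R] {κ : Type*} {S : Finset κ}
    {P : κ → MvPolynomial σ R} {a : κ → σ →₀ ℕ} (ha : ∀ k ∈ S, IsMaxExponent ω (P k) (a k)) :
    ∃ c, IsMaxExponent ω (∏ k ∈ S, P k) c ∧
      Finsupp.weight ω c = ∑ k ∈ S, Finsupp.weight ω (a k) := by
  classical
  induction S using Finset.induction_on with
  | empty =>
    refine ⟨0, ⟨?_, fun b hb => ?_⟩, by simp⟩
    · simp
    · rw [Finset.prod_empty, MvPolynomial.mem_support_iff, MvPolynomial.coeff_one] at hb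
      rw [of_not_not fun h => hb (if_neg h)]
  | insert k S hk ih =>
    obtain ⟨c, hc, hcw⟩ := ih fun j hj => ha j (Finset.mem_insert_of_mem hj)
    obtain ⟨d, hd, hdw⟩ := (ha k (Finset.mem_insert_self k S)).exists_mul hc
    rw [Finset.prod_insert hk, Finset.sum_insert hk]
    exact ⟨d, hd, hdw.trans (by rw [hcw])⟩

/-- Two weights have a common maximal exponent of a product exactly if they have one of each
factor. -/
theorem exists_common_isMaxExponent_prod_iff [IsDomain R] {κ : Type*} {S : Finset κ}
    {P : κ → MvPolynomial σ R} (hP : ∀ k ∈ S, P k ≠ 0) :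
    (∃ c, IsMaxExponent ω (∏ k ∈ S, P k) c ∧ IsMaxExponent ω' (∏ k ∈ S, P k) c) ↔
      ∀ k ∈ S, ∃ a, IsMaxExponent ω (P k) a ∧ IsMaxExponent ω' (P k) a := by
  classical
  have hex : ∀ θ : σ → ℝ, ∃ a : κ → σ →₀ ℕ, ∀ k ∈ S, IsMaxExponent θ (P k) (a k) := fun θ => by
    have : ∀ k, ∃ a, k ∈ S → IsMaxExponent θ (P k) a := fun k => by
      by_cases hk : k ∈ S
      · exact (exists_isMaxExponent θ (hP k hk)).imp fun _ h _ => h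
      · exact ⟨0, fun h => absurd h hk⟩
    choose a ha using this
    exact ⟨a, ha⟩
  obtain ⟨a, ha⟩ := hex ω
  obtain ⟨a', ha'⟩ := hex ω'
  obtain ⟨d, hd, hdw⟩ := exists_isMaxExponent_prod ha
  obtain ⟨d', hd', hdw'⟩ := exists_isMaxExponent_prod ha'
  constructor
  · rintro ⟨c, hc, hc'⟩
    obtain ⟨b, hb⟩ := hex (ω + ω')
    obtain ⟨e, he, hew⟩ := exists_isMaxExponent_prod hb
    have h1 := he.2 c hc.1
    have h2 := hc.2 d hd.1
    have h3 := hc'.2 d' hd'.1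
    rw [weight_add_weights, hew] at h1
    have hle : ∀ k ∈ S, Finsupp.weight (ω + ω') (b k) ≤
        Finsupp.weight ω (a k) + Finsupp.weight ω' (a' k) := fun k hk => by
      rw [weight_add_weights]
      exact add_le_add ((ha k hk).2 _ (hb k hk).1) ((ha' k hk).2 _ (hb k hk).1)
    -- Each factor's maximum for ω + ω' is at most the sum of its two maxima. The common maximizer
    -- of the product makes the totals equal, so equality holds for every factor.
    have heq := (Finset.sum_eq_sum_iff_of_le hle).1 (le_antisymm (Finset.sum_le_sum hle) (by
      rw [Finset.sum_add_distrib]; linarith))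
    intro k hk
    have h4 := heq k hk
    rw [weight_add_weights] at h4
    have h5 := (ha k hk).2 _ (hb k hk).1
    have h6 := (ha' k hk).2 _ (hb k hk).1
    refine ⟨b k, ⟨(hb k hk).1, fun x hx => ?_⟩, ⟨(hb k hk).1, fun x hx => ?_⟩⟩
    · have := (ha k hk).2 x hx; linarith
    · have := (ha' k hk).2 x hx; linarith
  · intro h
    have : ∀ k, ∃ b, k ∈ S → IsMaxExponent ω (P k) b ∧ IsMaxExponent ω' (P k) b := fun k => by
      by_cases hk : k ∈ S
      · exact (h k hk).imp fun _ h _ => h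
      · exact ⟨0, fun h => absurd h hk⟩
    choose b hb using this
    obtain ⟨u, hu, huw⟩ := exists_isMaxExponent_prod fun k hk => (hb k hk).1
    obtain ⟨u', hu', huw'⟩ := exists_isMaxExponent_prod fun k hk => (hb k hk).2
    have hθ : ∀ k ∈ S, IsMaxExponent (ω + ω') (P k) (b k) := fun k hk =>
      ⟨(hb k hk).1.1, fun x hx => by
        rw [weight_add_weights, weight_add_weights]
        exact add_le_add ((hb k hk).1.2 x hx) ((hb k hk).2.2 x hx)⟩
    obtain ⟨c, hc, hcw⟩ := exists_isMaxExponent_prod hθ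
    simp_rw [weight_add_weights, Finset.sum_add_distrib] at hcw
    have h1 := hu.2 c hc.1
    have h2 := hu'.2 c hc.1
    refine ⟨c, ⟨hc.1, fun x hx => ?_⟩, ⟨hc.1, fun x hx => ?_⟩⟩
    · have := hu.2 x hx; linarith
    · have := hu'.2 x hx; linarith

theorem commonMax_newtonPolytope_iff [DecidableEq σ] [Fintype σ] (p : MvPolynomial σ R)
    (l l' : StrongDual ℝ (σ → ℝ)) :
    CommonMax (newtonPolytope p) l l' ↔
      ∃ a, IsMaxExponent (dualVec l) p a ∧ IsMaxExponent (dualVec l') p a := by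
  rw [newtonPolytope, commonMax_convexHull_iff (p.support.finite_toSet.image _)]
  simp only [Set.exists_mem_image, Set.forall_mem_image, ← dualVec_dotProduct,
    ← weight_eq_dotProduct, IsMaxExponent, Finset.mem_coe]
  exact ⟨fun ⟨a, ha, h⟩ => ⟨a, ⟨ha, fun b hb => h.1 hb⟩, ha, fun b hb => h.2 hb⟩,
    fun ⟨a, h, h'⟩ => ⟨a, h.1, fun b hb => h.2 b hb, fun b hb => h'.2 b hb⟩⟩

end NewtonProduct

/-! ### The monomials of a minor of the generic matrix -/

section Minors

variable {m n : ℕ} {G : Finset (Fin m × Fin n)} {I : Finset (Fin m)} {J : Finset (Fin n)}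
  {f g : Fin m → Fin n}

/-- The graph of `f` over `I` is a perfect matching of `I` and `J` with edges in `G`. -/
def IsMatching (G : Finset (Fin m × Fin n)) (I : Finset (Fin m)) (J : Finset (Fin n))
    (f : Fin m → Fin n) : Prop :=
  Set.BijOn f I J ∧ ∀ i ∈ I, (i, f i) ∈ G

/-- The indicator of the graph of `f` over `I`. -/
def matchVec (G : Finset (Fin m × Fin n)) (I : Finset (Fin m)) (f : Fin m → Fin n) : G →₀ ℕ :=
  Finsupp.equivFunOnFinite.symm fun e => if e.1.1 ∈ I ∧ f e.1.1 = e.1.2 then 1 else 0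

theorem matchVec_apply (e : G) :
    matchVec G I f e = if e.1.1 ∈ I ∧ f e.1.1 = e.1.2 then 1 else 0 := rfl

theorem matchVec_eq_sum (hf : ∀ i ∈ I, (i, f i) ∈ G) :
    matchVec G I f = ∑ i : I, Finsupp.single ⟨(i.1, f i), hf i i.2⟩ 1 := by
  classical
  ext e
  rw [matchVec_apply, Finsupp.finsetSum_apply]
  simp only [Finsupp.single_apply]
  split_ifs with h
  · rw [Finset.sum_eq_single (⟨e.1.1, h.1⟩ : I)]
    · exact (if_pos (Subtype.ext (Prod.ext (by rfl) h.2))).symm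
    · intro i _ hi
      refine if_neg fun he => hi (Subtype.ext ?_)
      exact congrArg (fun e : G => e.1.1) he
    · simp
  · refine (Finset.sum_eq_zero fun i _ => if_neg fun he => h ?_).symm
    rw [← he]
    exact ⟨i.2, rfl⟩

theorem prod_genericMatrix (I : Finset (Fin m)) (f : Fin m → Fin n)
    [Decidable (∀ i ∈ I, (i, f i) ∈ G)] :
    ∏ i ∈ I, genericMatrix G i (f i) =
      if ∀ i ∈ I, (i, f i) ∈ G then MvPolynomial.monomial (matchVec G I f) 1 else 0 := by
  split_ifs with h
  · rw [matchVec_eq_sum h, MvPolynomial.monomial_sum_one, ← Finset.prod_coe_sort]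
    refine Finset.prod_congr rfl fun i _ => ?_
    rw [genericMatrix, Matrix.of_apply, dif_pos (h i i.2)]
    rfl
  · push Not at h
    obtain ⟨i, hi, hiG⟩ := h
    exact Finset.prod_eq_zero hi (by rw [genericMatrix, Matrix.of_apply, dif_neg hiG])

theorem exists_bijOn_of_perm [Nonempty (Fin n)] (h : I.card = J.card)
    (σ : Equiv.Perm (Fin I.card)) :
    ∃ f : Fin m → Fin n, Set.BijOn f I J ∧
      ∀ t, f (I.orderEmbOfFin rfl t) = J.orderEmbOfFin h.symm (σ t) := by
  have hinj := (I.orderEmbOfFin rfl).injective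
  refine ⟨Function.extend (I.orderEmbOfFin rfl) (fun t => J.orderEmbOfFin h.symm (σ t))
    (fun _ => Classical.arbitrary _), ?_, fun t => hinj.extend_apply _ _ t⟩
  rw [← Finset.range_orderEmbOfFin I rfl, ← Finset.range_orderEmbOfFin J h.symm]
  refine ⟨?_, ?_, ?_⟩
  · rintro _ ⟨t, rfl⟩
    rw [hinj.extend_apply]
    exact ⟨σ t, rfl⟩
  · rintro _ ⟨t, rfl⟩ _ ⟨s, rfl⟩ hts
    rw [hinj.extend_apply, hinj.extend_apply] at hts
    rw [σ.injective ((J.orderEmbOfFin h.symm).injective hts)]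
  · rintro _ ⟨t, rfl⟩
    exact ⟨_, ⟨σ.symm t, rfl⟩, by rw [hinj.extend_apply, σ.apply_symm_apply]⟩

theorem exists_perm_of_bijOn (h : I.card = J.card) (hf : Set.BijOn f I J) :
    ∃ σ : Equiv.Perm (Fin I.card),
      ∀ t, f (I.orderEmbOfFin rfl t) = J.orderEmbOfFin h.symm (σ t) := by
  have hex : ∀ t, ∃ s, J.orderEmbOfFin h.symm s = f (I.orderEmbOfFin rfl t) := fun t => by
    have := hf.mapsTo (Finset.orderEmbOfFin_mem I rfl t)
    rwa [← Finset.range_orderEmbOfFin J h.symm] at this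
  choose s hs using hex
  have hinj : Function.Injective s := fun t t' htt => by
    have := (hs t).symm.trans ((congrArg _ htt).trans (hs t'))
    exact (I.orderEmbOfFin rfl).injective (hf.injOn (Finset.orderEmbOfFin_mem I rfl t)
      (Finset.orderEmbOfFin_mem I rfl t') this)
  exact ⟨Equiv.ofBijective s (Finite.injective_iff_bijective.1 hinj), fun t => (hs t).symm⟩

theorem prod_orderEmbOfFin {M : Type*} [CommMonoid M] (F : Fin m → M) :
    ∏ t, F (I.orderEmbOfFin rfl t) = ∏ i ∈ I, F i := by
  conv_rhs => rw [← Finset.map_orderEmbOfFin_univ I rfl, Finset.prod_map]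
  rfl

/-- Distinct permutations yield distinct monomials because the nonzero entries are distinct
indeterminates, so no terms of the determinant cancel. -/
theorem mem_support_minor_iff [Nonempty (Fin n)] (h : I.card = J.card) {a : G →₀ ℕ} :
    a ∈ (minor (genericMatrix G) I J h).support ↔ ∃ f, IsMatching G I J f ∧ a = matchVec G I f := by
  classical
  choose F hF hFσ using exists_bijOn_of_perm (I := I) (J := J) h
  have hminor : minor (genericMatrix G) I J h = ∑ σ : Equiv.Perm (Fin I.card),
      ((Equiv.Perm.sign σ : ℤ) : MvPolynomial G ℤ) *
        if ∀ i ∈ I, (i, F σ i) ∈ G then MvPolynomial.monomial (matchVec G I (F σ)) 1 else 0 := by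
    rw [minor, ← Matrix.det_transpose, Matrix.det_apply']
    refine Finset.sum_congr rfl fun σ _ => ?_
    rw [← prod_genericMatrix, ← prod_orderEmbOfFin (I := I) fun i => genericMatrix G i (F σ i)]
    simp [hFσ]
  have hcoeff : MvPolynomial.coeff a (minor (genericMatrix G) I J h) =
      ∑ σ : Equiv.Perm (Fin I.card), (Equiv.Perm.sign σ : ℤ) *
        if (∀ i ∈ I, (i, F σ i) ∈ G) ∧ matchVec G I (F σ) = a then 1 else 0 := by
    rw [hminor, MvPolynomial.coeff_sum]
    refine Finset.sum_congr rfl fun σ _ => ?_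
    rw [← eq_intCast (MvPolynomial.C : ℤ →+* MvPolynomial G ℤ), MvPolynomial.coeff_C_mul]
    split_ifs with h1 h2 h2
    · simp [h2.2]
    · rw [MvPolynomial.coeff_monomial, if_neg fun h3 => h2 ⟨h1, h3⟩]
    · exact absurd h2.1 h1
    · simp
  rw [MvPolynomial.mem_support_iff, hcoeff]
  constructor
  · intro hne
    obtain ⟨σ, -, hσ⟩ := Finset.exists_ne_zero_of_sum_ne_zero hne
    have : (∀ i ∈ I, (i, F σ i) ∈ G) ∧ matchVec G I (F σ) = a := by
      by_contra hcon
      rw [if_neg hcon, mul_zero] at hσ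
      exact hσ rfl
    exact ⟨F σ, ⟨hF σ, this.1⟩, this.2.symm⟩
  · rintro ⟨f, ⟨hf, hfG⟩, rfl⟩
    obtain ⟨σ₀, hσ₀⟩ := exists_perm_of_bijOn h hf
    have heq : ∀ i ∈ I, F σ₀ i = f i := fun i hi => by
      have hi' : i ∈ Set.range (I.orderEmbOfFin rfl) := by
        rwa [Finset.range_orderEmbOfFin]
      obtain ⟨t, rfl⟩ := hi'
      rw [hFσ, hσ₀]
    rw [Finset.sum_eq_single σ₀, if_pos]
    · simp
    · refine ⟨fun i hi => by rw [heq i hi]; exact hfG i hi, ?_⟩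
      ext e
      rw [matchVec_apply, matchVec_apply]
      refine if_congr (and_congr_right fun he => ?_) rfl rfl
      rw [heq _ he]
    · intro σ _ hne
      rw [if_neg, mul_zero]
      rintro ⟨-, h2⟩
      refine hne (Equiv.ext fun t => ?_)
      have ht := Finset.orderEmbOfFin_mem I rfl t
      have h3 := DFunLike.congr_fun h2 ⟨(_, f (I.orderEmbOfFin rfl t)), hfG _ ht⟩
      simp only [matchVec_apply, ht, true_and, if_true] at h3
      have h4 : F σ (I.orderEmbOfFin rfl t) = f (I.orderEmbOfFin rfl t) := by
        by_contra hcon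
        simp [hcon] at h3
      rw [hFσ, hσ₀] at h4
      exact (J.orderEmbOfFin h.symm).injective h4
    · simp

end Minors

/-! ### Alternating cycles -/

section Alternating

variable {m n : ℕ}

/-- In a nonempty stable subset of least cardinality, the image is again stable, hence everything,
and a surjection of a finite set onto itself is bijective. -/
theorem exists_finset_bijOn_self {α : Type*} [DecidableEq α] {S : Finset α} (hS : S.Nonempty)
    {q : α → α} (hq : ∀ i ∈ S, q i ∈ S) : ∃ I ⊆ S, I.Nonempty ∧ Set.BijOn q I I := by
  obtain ⟨I, hI, hmin⟩ := Finset.exists_min_image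
    (S.powerset.filter fun I => I.Nonempty ∧ I.image q ⊆ I) Finset.card
    ⟨S, by simpa [hS, Finset.image_subset_iff] using hq⟩
  simp only [Finset.mem_filter, Finset.mem_powerset] at hI hmin
  have hcard := hmin (I.image q)
    ⟨hI.2.2.trans hI.1, hI.2.1.image q, Finset.image_subset_image hI.2.2⟩
  have heq : I.image q = I := Finset.eq_of_subset_of_card_le hI.2.2 hcard
  refine ⟨I, hI.1, hI.2.1, fun i hi => hI.2.2 (Finset.mem_image_of_mem q hi),
    Finset.card_image_iff.1 (by rw [heq]), ?_⟩
  have := congrArg (fun s : Finset α => (s : Set α)) heq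
  simp only [Finset.coe_image] at this
  exact this.ge

/-- A nonzero matrix with vanishing row and column sums has two perfect matchings of the same sets
of rows and columns, one with positive and one with negative entries. -/
theorem exists_alternating_matchings [Nonempty (Fin n)] {κ : Matrix (Fin m) (Fin n) ℝ}
    (hrow : ∀ i, ∑ j, κ i j = 0) (hcol : ∀ j, ∑ i, κ i j = 0) (hκ : κ ≠ 0) :
    ∃ (I : Finset (Fin m)) (J : Finset (Fin n)) (f g : Fin m → Fin n), I.Nonempty ∧
      Set.BijOn f I J ∧ Set.BijOn g I J ∧ (∀ i ∈ I, 0 < κ i (f i)) ∧ ∀ i ∈ I, κ i (g i) < 0 := by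
  classical
  have hpos : ∀ i, (∃ j, κ i j ≠ 0) → ∃ j, 0 < κ i j := fun i ⟨j, hj⟩ => by
    obtain ⟨j', -, h⟩ := Finset.exists_pos_of_sum_zero_of_exists_nonzero _ (hrow i)
      ⟨j, Finset.mem_univ j, hj⟩
    exact ⟨j', h⟩
  have hneg : ∀ j, (∃ i, κ i j ≠ 0) → ∃ i, κ i j < 0 := fun j ⟨i, hi⟩ => by
    obtain ⟨i', -, h⟩ := Finset.exists_pos_of_sum_zero_of_exists_nonzero (fun i => -κ i j)
      (by rw [Finset.sum_neg_distrib, hcol, neg_zero]) ⟨i, Finset.mem_univ i, neg_ne_zero.2 hi⟩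
    exact ⟨i', neg_pos.1 h⟩
  obtain ⟨i₀, j₀, h₀⟩ : ∃ i j, κ i j ≠ 0 := by
    by_contra! hcon
    exact hκ (Matrix.ext hcon)
  have : Nonempty (Fin m) := ⟨i₀⟩
  have hp : ∀ i, ∃ j, (∃ j, κ i j ≠ 0) → 0 < κ i j := fun i => by
    by_cases h : ∃ j, κ i j ≠ 0
    · exact (hpos i h).imp fun _ h _ => h
    · exact ⟨Classical.arbitrary _, fun h' => absurd h' h⟩
  have hr : ∀ j, ∃ i, (∃ i, κ i j ≠ 0) → κ i j < 0 := fun j => by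
    by_cases h : ∃ i, κ i j ≠ 0
    · exact (hneg j h).imp fun _ h _ => h
    · exact ⟨Classical.arbitrary _, fun h' => absurd h' h⟩
  choose p hp using hp
  choose r hr using hr
  have hr' : ∀ i, (∃ j, κ i j ≠ 0) → κ (r (p i)) (p i) < 0 := fun i hi =>
    hr _ ⟨i, (hp i hi).ne'⟩
  -- From a row, `p` moves to a column along a positive entry and `r` back to a row along a negative
  -- one. On a set of rows permuted by this walk, the two kinds of entries form the two matchings.
  obtain ⟨I, hIS, hI, hbij⟩ := exists_finset_bijOn_self (S := Finset.univ.filter fun i =>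
    ∃ j, κ i j ≠ 0) (q := r ∘ p) ⟨i₀, by simpa using ⟨j₀, h₀⟩⟩ (fun i hi => by
      simp only [Finset.mem_filter, Finset.mem_univ, true_and] at hi ⊢
      exact ⟨_, (hr' i hi).ne⟩)
  have hIS' : ∀ i ∈ I, ∃ j, κ i j ≠ 0 := fun i hi => by simpa using hIS hi
  have hpinj : Set.InjOn p I := fun i hi i' hi' h => hbij.injOn hi hi' (congrArg r h)
  have hpb : Set.BijOn p I (I.image p : Finset (Fin n)) := by
    rw [Finset.coe_image]
    exact hpinj.bijOn_image
  have hinv := hbij.invOn_invFunOn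
  have hib : Set.BijOn (Function.invFunOn (r ∘ p) I) I I :=
    hinv.symm.bijOn hbij.surjOn.mapsTo_invFunOn hbij.mapsTo
  -- The negative matching sends a row to the column from which the walk enters it, hence the
  -- inverse of `r ∘ p`.
  refine ⟨I, I.image p, p, p ∘ Function.invFunOn (r ∘ p) I, hI, hpb, hpb.comp hib,
    fun i hi => hp i (hIS' i hi), fun i hi => ?_⟩
  have h1 := hr' _ (hIS' _ (hib.mapsTo hi))
  have h2 : r (p (Function.invFunOn (r ∘ p) I i)) = i := hinv.2 hi
  rwa [h2] at h1

end Alternating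

/-! ### Optimal weights on root polytopes and optimal matchings -/

section RootPolytopes

variable {m n : ℕ} {G : Finset (Fin m × Fin n)} {I : Finset (Fin m)} {J : Finset (Fin n)}
  {f : Fin m → Fin n} {ω ω' w : G → ℝ}

theorem rootPoints_injective : Function.Injective (rootPoints G) := by
  intro e e' h
  have h1 := congrArg (fun x : EuclideanSpace ℝ (Fin m ⊕ Fin n) => x (Sum.inl e.1.1)) h
  have h2 := congrArg (fun x : EuclideanSpace ℝ (Fin m ⊕ Fin n) => x (Sum.inr e.1.2)) h
  simp [rootPoints] at h1 h2
  exact Subtype.ext (Prod.ext h1 h2)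

/-- The matrix with the entries `w` on `G` and zero elsewhere. -/
def edgeMatrix (w : G → ℝ) : Matrix (Fin m) (Fin n) ℝ :=
  Matrix.of fun i j => if h : (i, j) ∈ G then w ⟨(i, j), h⟩ else 0

theorem edgeMatrix_apply_of_mem {i : Fin m} {j : Fin n} (h : (i, j) ∈ G) :
    edgeMatrix w i j = w ⟨(i, j), h⟩ := dif_pos h

theorem edgeMatrix_apply_of_notMem {i : Fin m} {j : Fin n} (h : (i, j) ∉ G) :
    edgeMatrix w i j = 0 := dif_neg h

theorem edgeMatrix_coe (e : G) : edgeMatrix w e.1.1 e.1.2 = w e :=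
  edgeMatrix_apply_of_mem e.2

theorem edgeMatrix_nonneg (hw : ∀ e, 0 ≤ w e) (i : Fin m) (j : Fin n) :
    0 ≤ edgeMatrix w i j := by
  by_cases h : (i, j) ∈ G
  · rw [edgeMatrix_apply_of_mem h]; exact hw _
  · rw [edgeMatrix_apply_of_notMem h]

theorem sum_edges_eq (c : Fin m → Fin n → ℝ) :
    ∑ e : G, w e * c e.1.1 e.1.2 = ∑ i, ∑ j, edgeMatrix w i j * c i j := by
  rw [← Fintype.sum_prod_type' fun i j => edgeMatrix w i j * c i j,
    ← sum_coe_eq_sum (T := G) fun p hp => by rw [edgeMatrix_apply_of_notMem hp, zero_mul]]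
  exact Finset.sum_congr rfl fun e _ => by rw [edgeMatrix_coe]

theorem comb_rootPoints_inl (w : G → ℝ) (i : Fin m) :
    comb (rootPoints G) w (Sum.inl i) = ∑ j, edgeMatrix w i j := by
  have h := sum_edges_eq (w := w) fun i' _ => if i = i' then 1 else 0
  simp only [mul_ite, mul_one, mul_zero, Finset.sum_ite_irrel, Finset.sum_const_zero,
    Finset.sum_ite_eq, Finset.mem_univ, if_true] at h
  rw [← h, Fintype.linearCombination_apply]
  simp [rootPoints, Pi.single_apply]

theorem comb_rootPoints_inr (w : G → ℝ) (j : Fin n) :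
    comb (rootPoints G) w (Sum.inr j) = -∑ i, edgeMatrix w i j := by
  have h := sum_edges_eq (w := w) fun _ j' => if j = j' then 1 else 0
  simp only [mul_ite, mul_one, mul_zero, Finset.sum_ite_eq,
    Finset.mem_univ, if_true] at h
  rw [← h, Fintype.linearCombination_apply]
  simp [rootPoints, Pi.single_apply]

/-- The exponent vector of a matching as a weight vector. -/
def matchWeights (G : Finset (Fin m × Fin n)) (I : Finset (Fin m)) (f : Fin m → Fin n) : G → ℝ :=
  fun e => (matchVec G I f e : ℝ)

theorem matchWeights_nonneg (e : G) : 0 ≤ matchWeights G I f e := Nat.cast_nonneg _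

theorem matchWeights_ne_zero_iff {e : G} :
    matchWeights G I f e ≠ 0 ↔ e.1.1 ∈ I ∧ f e.1.1 = e.1.2 := by
  simp [matchWeights, matchVec_apply]

theorem sum_matchWeights_smul {M : Type*} [AddCommGroup M] [Module ℝ M]
    (hf : ∀ i ∈ I, (i, f i) ∈ G) (F : G → M) :
    ∑ e, matchWeights G I f e • F e = ∑ i : I, F ⟨(i, f i), hf i i.2⟩ := by
  classical
  simp_rw [matchWeights, matchVec_eq_sum hf, Finsupp.finsetSum_apply, Nat.cast_sum,
    Finset.sum_smul]
  rw [Finset.sum_comm]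
  refine Finset.sum_congr rfl fun i _ => ?_
  simp [Finsupp.single_apply]

theorem sum_matchWeights (hf : ∀ i ∈ I, (i, f i) ∈ G) :
    ∑ e, matchWeights G I f e = I.card := by
  simpa using sum_matchWeights_smul hf fun _ => (1 : ℝ)

theorem comb_matchWeights (hf : IsMatching G I J f) :
    comb (rootPoints G) (matchWeights G I f) =
      ∑ i ∈ I, EuclideanSpace.single (Sum.inl i) (1 : ℝ) -
        ∑ j ∈ J, EuclideanSpace.single (Sum.inr j) (1 : ℝ) := by
  rw [Fintype.linearCombination_apply, sum_matchWeights_smul hf.2]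
  simp only [rootPoints]
  rw [Finset.sum_sub_distrib,
    Finset.sum_coe_sort I fun i => EuclideanSpace.single (Sum.inl i : Fin m ⊕ Fin n) (1 : ℝ),
    Finset.sum_coe_sort I fun i => EuclideanSpace.single (Sum.inr (f i) : Fin m ⊕ Fin n) (1 : ℝ)]
  congr 1
  exact Finset.sum_nbij f (fun i hi => hf.1.mapsTo hi) hf.1.injOn hf.1.surjOn fun _ _ => rfl

theorem weight_matchVec (ω : G → ℝ) :
    Finsupp.weight ω (matchVec G I f) = ω ⬝ᵥ matchWeights G I f :=
  weight_eq_dotProduct ω _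

/-- Weights whose point is a positive multiple of that of a matching of `I` and `J` contain a
matching of `I` and `J` in their support. -/
theorem exists_isMatching_support_subset [Nonempty (Fin n)] (h : I.card = J.card)
    (hw : ∀ e, 0 ≤ w e) {c : ℝ} (hc : 0 < c)
    (hcomb : comb (rootPoints G) w = c • (∑ i ∈ I, EuclideanSpace.single (Sum.inl i) (1 : ℝ) -
        ∑ j ∈ J, EuclideanSpace.single (Sum.inr j) (1 : ℝ))) :
    ∃ f, IsMatching G I J f ∧ ∀ e, w e = 0 → matchWeights G I f e = 0 := by
  classical
  have hrow : ∀ i, ∑ j, edgeMatrix w i j = if i ∈ I then c else 0 := fun i => by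
    rw [← comb_rootPoints_inl, hcomb]
    simp [Pi.single_apply]
  have hcol : ∀ j, ∑ i, edgeMatrix w i j = if j ∈ J then c else 0 := fun j => by
    rw [← neg_neg (∑ i, edgeMatrix w i j), ← comb_rootPoints_inr, hcomb]
    simp [Pi.single_apply]
  have hn := edgeMatrix_nonneg hw
  have hrow0 : ∀ i ∉ I, ∀ j, edgeMatrix w i j = 0 := fun i hi j =>
    (Finset.sum_eq_zero_iff_of_nonneg fun j _ => hn i j).1 (by rw [hrow, if_neg hi]) j
      (Finset.mem_univ j)
  have hcol0 : ∀ j ∉ J, ∀ i, edgeMatrix w i j = 0 := fun j hj i =>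
    (Finset.sum_eq_zero_iff_of_nonneg fun i _ => hn i j).1 (by rw [hcol, if_neg hj]) i
      (Finset.mem_univ i)
  set r := I.orderEmbOfFin rfl with hr
  set s := J.orderEmbOfFin h.symm with hs
  have hsumI : ∀ F : Fin m → ℝ, ∑ t, F (r t) = ∑ i ∈ I, F i := fun F => by
    conv_rhs => rw [← Finset.map_orderEmbOfFin_univ I rfl, Finset.sum_map]
    rfl
  have hsumJ : ∀ F : Fin n → ℝ, ∑ t, F (s t) = ∑ j ∈ J, F j := fun F => by
    conv_rhs => rw [← Finset.map_orderEmbOfFin_univ J h.symm, Finset.sum_map]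
    rfl
  -- Rescaled by `c⁻¹`, the block on I × J is doubly stochastic; a permutation with nonzero
  -- coefficient in its Birkhoff decomposition is the matching.
  have hD : Matrix.of (fun t u => c⁻¹ * edgeMatrix w (r t) (s u)) ∈
      doublyStochastic ℝ (Fin I.card) := by
    rw [mem_doublyStochastic_iff_sum]
    simp only [Matrix.of_apply, ← Finset.mul_sum]
    refine ⟨fun t u => mul_nonneg (inv_nonneg.2 hc.le) (hn _ _), fun t => ?_, fun u => ?_⟩
    · rw [hsumJ, Finset.sum_subset (Finset.subset_univ J) fun j _ hj => hcol0 j hj _, hrow,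
        if_pos (Finset.orderEmbOfFin_mem I rfl t), inv_mul_cancel₀ hc.ne']
    · rw [hsumI fun i => edgeMatrix w i (s u),
        Finset.sum_subset (Finset.subset_univ I) fun i _ hi => hrow0 i hi _, hcol,
        if_pos (Finset.orderEmbOfFin_mem J h.symm u), inv_mul_cancel₀ hc.ne']
  obtain ⟨μ, hμ0, hμ1, hμ⟩ := exists_eq_sum_perm_of_mem_doublyStochastic hD
  obtain ⟨σ, -, hσ⟩ := Finset.exists_ne_zero_of_sum_ne_zero (hμ1.trans_ne one_ne_zero)
  have hpos : ∀ t, edgeMatrix w (r t) (s (σ t)) ≠ 0 := fun t h0 => by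
    have h1 := congrFun (congrFun hμ t) (σ t)
    rw [Matrix.of_apply, h0, mul_zero, Matrix.sum_apply] at h1
    have h2 := (Finset.sum_eq_zero_iff_of_nonneg fun τ _ => by
      simp only [Matrix.smul_apply, smul_eq_mul, Equiv.Perm.permMatrix, PEquiv.toMatrix_apply]
      exact mul_nonneg (hμ0 τ) (by split_ifs <;> norm_num)).1 h1 σ (Finset.mem_univ σ)
    simp [Equiv.Perm.permMatrix, PEquiv.toMatrix_apply] at h2
    exact hσ h2
  obtain ⟨f, hf, hfσ⟩ := exists_bijOn_of_perm h σ
  have hfpos : ∀ i ∈ I, edgeMatrix w i (f i) ≠ 0 := fun i hi => by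
    have hi' : i ∈ Set.range r := by rwa [hr, Finset.range_orderEmbOfFin]
    obtain ⟨t, rfl⟩ := hi'
    rw [hr, hfσ]
    exact hpos t
  refine ⟨f, ⟨hf, fun i hi => ?_⟩, fun e he => ?_⟩
  · by_contra hG
    exact hfpos i hi (edgeMatrix_apply_of_notMem hG)
  · by_contra hne
    rw [← Ne, matchWeights_ne_zero_iff] at hne
    refine hfpos _ hne.1 ?_
    rw [hne.2, edgeMatrix_coe, he]

/-- All matchings of (I, J) represent the same point up to the factor |I|. A matching inside the
support of common optimal weights there cannot be improved by another one, for either weight. -/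
theorem exists_common_isMaxExponent_minor [Nonempty (Fin n)]
    (H : ∀ v ∈ stdSimplex ℝ G, ∃ w, comb (rootPoints G) w = comb (rootPoints G) v ∧
      IsOptimal (rootPoints G) ω w ∧ IsOptimal (rootPoints G) ω' w)
    (h : I.card = J.card) (h0 : minor (genericMatrix G) I J h ≠ 0) :
    ∃ a, IsMaxExponent ω (minor (genericMatrix G) I J h) a ∧
      IsMaxExponent ω' (minor (genericMatrix G) I J h) a := by
  obtain ⟨a, ha⟩ := MvPolynomial.support_nonempty.2 h0
  obtain ⟨f₀, hf₀, rfl⟩ := (mem_support_minor_iff h).1 ha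
  -- The empty minor has only the zero exponent and cannot be normalized by |I|.
  rcases I.eq_empty_or_nonempty with rfl | hI
  · have hall : ∀ b ∈ (minor (genericMatrix G) ∅ J h).support, b = matchVec G ∅ f₀ := by
      intro b hb
      obtain ⟨f, -, rfl⟩ := (mem_support_minor_iff h).1 hb
      ext e
      simp [matchVec_apply]
    exact ⟨_, ⟨ha, fun b hb => by rw [hall b hb]⟩, ⟨ha, fun b hb => by rw [hall b hb]⟩⟩
  · have hk : (0 : ℝ) < (I.card : ℝ)⁻¹ := inv_pos.2 (by exact_mod_cast hI.card_pos)
    obtain ⟨w, hc, h1, h2⟩ := H ((I.card : ℝ)⁻¹ • matchWeights G I f₀)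
      ⟨fun e => mul_nonneg hk.le (matchWeights_nonneg e), by
        simp only [Pi.smul_apply, smul_eq_mul, ← Finset.mul_sum, sum_matchWeights hf₀.2]
        exact inv_mul_cancel₀ (inv_pos.1 hk).ne'⟩
    rw [map_smul, comb_matchWeights hf₀] at hc
    obtain ⟨f, hf, hsupp⟩ := exists_isMatching_support_subset h h1.1.1 hk hc
    have hmax : ∀ {θ : G → ℝ}, IsOptimal (rootPoints G) θ w →
        IsMaxExponent θ (minor (genericMatrix G) I J h) (matchVec G I f) := fun hθ => by
      refine ⟨(mem_support_minor_iff h).2 ⟨f, hf, rfl⟩, fun b hb => ?_⟩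
      obtain ⟨f', hf', rfl⟩ := (mem_support_minor_iff h).1 hb
      rw [weight_matchVec, weight_matchVec]
      exact hθ.dotProduct_le matchWeights_nonneg
        (by rw [sum_matchWeights hf.2, sum_matchWeights hf'.2])
        (by rw [comb_matchWeights hf, comb_matchWeights hf']) hsupp
    exact ⟨_, hmax h1, hmax h2⟩

theorem exists_nearest_isOptimal (A : G → EuclideanSpace ℝ (Fin m ⊕ Fin n))
    (hw : w ∈ stdSimplex ℝ G) (ω : G → ℝ) :
    ∃ u, IsOptimal A ω u ∧ comb A u = comb A w ∧
      ∀ u', IsOptimal A ω u' → comb A u' = comb A w → ∑ e, |w e - u e| ≤ ∑ e, |w e - u' e| := by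
  obtain ⟨v, hv, hvc⟩ := exists_isOptimal (A := A) ω hw
  -- Over the fixed point, reaching the optimal value attained by `v` is a closed condition that
  -- describes the ω-optimal weights.
  have hcl : IsClosed (comb A ⁻¹' {comb A w} ∩ {u | ω ⬝ᵥ v ≤ ω ⬝ᵥ u}) :=
    (isClosed_singleton.preimage (comb A).continuous_of_finiteDimensional).inter
      (isClosed_le continuous_const (by unfold dotProduct; fun_prop))
  obtain ⟨u, hu, hmin⟩ := ((isCompact_stdSimplex ℝ G).inter_right hcl).exists_isMinOn
    ⟨v, hv.1, hvc, le_refl (ω ⬝ᵥ v)⟩ (f := fun u => ∑ e, |w e - u e|) (by fun_prop)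
  refine ⟨u, ⟨hu.1, fun u' hu' hc => ?_⟩, hu.2.1, fun u' hu' hc => ?_⟩
  · exact (hv.2 u' hu' (hc.trans (hu.2.1.trans hvc.symm))).trans hu.2.2
  · exact hmin ⟨hu'.1, hc, hu'.2 v hv.1 (hvc.trans hc.symm)⟩

/-- The exchange argument: any discrepancy between `w` and the nearest ω-optimal weights of the same
point could be reduced along a pair of alternating matchings. -/
theorem IsOptimal.left_of_add [Nonempty (Fin n)]
    (H : ∀ I J, ∀ h : I.card = J.card, minor (genericMatrix G) I J h ≠ 0 →
      ∃ a, IsMaxExponent ω (minor (genericMatrix G) I J h) a ∧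
        IsMaxExponent ω' (minor (genericMatrix G) I J h) a)
    (hw : IsOptimal (rootPoints G) (ω + ω') w) : IsOptimal (rootPoints G) ω w := by
  classical
  obtain ⟨u, hu, huc, hmin⟩ := exists_nearest_isOptimal (rootPoints G) hw.1 ω
  suffices w = u from this ▸ hu
  by_contra hne
  set κ : G → ℝ := w - u with hκ
  have hκc : comb (rootPoints G) κ = 0 := by rw [hκ, map_sub, huc, sub_self]
  have hrow : ∀ i, ∑ j, edgeMatrix κ i j = 0 := fun i => by
    rw [← comb_rootPoints_inl, hκc]; rfl
  have hcol : ∀ j, ∑ i, edgeMatrix κ i j = 0 := fun j => by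
    rw [← neg_eq_zero, ← comb_rootPoints_inr, hκc]; rfl
  have hκ0 : edgeMatrix κ ≠ 0 := fun h => hne (by
    rw [← sub_eq_zero]
    funext e
    have := congrFun (congrFun h e.1.1) e.1.2
    rwa [edgeMatrix_coe] at this)
  obtain ⟨I, J, f, g, hI, hfb, hgb, hfp, hgn⟩ := exists_alternating_matchings hrow hcol hκ0
  have hf : IsMatching G I J f := ⟨hfb, fun i hi => by
    by_contra hG; exact (hfp i hi).ne' (edgeMatrix_apply_of_notMem hG)⟩
  have hg : IsMatching G I J g := ⟨hgb, fun i hi => by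
    by_contra hG; exact (hgn i hi).ne (edgeMatrix_apply_of_notMem hG)⟩
  have hfκ : ∀ e, ¬ 0 < κ e → matchWeights G I f e = 0 := fun e he => by
    by_contra hne
    rw [← Ne, matchWeights_ne_zero_iff] at hne
    have := hfp _ hne.1
    rw [hne.2, edgeMatrix_coe] at this
    exact he this
  have hgκ : ∀ e, ¬ κ e < 0 → matchWeights G I g e = 0 := fun e he => by
    by_contra hne
    rw [← Ne, matchWeights_ne_zero_iff] at hne
    have := hgn _ hne.1
    rw [hne.2, edgeMatrix_coe] at this
    exact he this
  have hκe : ∀ e, κ e = w e - u e := fun e => rfl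
  have hcard : I.card = J.card := by
    have h1 := hfb.injOn.ncard_image
    rw [hfb.image_eq, Set.ncard_coe_finset, Set.ncard_coe_finset] at h1
    exact h1.symm
  have hfs : matchVec G I f ∈ (minor (genericMatrix G) I J hcard).support :=
    (mem_support_minor_iff hcard).2 ⟨f, hf, rfl⟩
  have hgs : matchVec G I g ∈ (minor (genericMatrix G) I J hcard).support :=
    (mem_support_minor_iff hcard).2 ⟨g, hg, rfl⟩
  obtain ⟨a, ha, ha'⟩ := H I J hcard (MvPolynomial.support_nonempty.1 ⟨_, hfs⟩)
  obtain ⟨p, hp, rfl⟩ := (mem_support_minor_iff hcard).1 ha.1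
  have hsum : ∀ {q q'}, IsMatching G I J q → IsMatching G I J q' →
      ∑ e, matchWeights G I q e = ∑ e, matchWeights G I q' e := fun hq hq' => by
    rw [sum_matchWeights hq.2, sum_matchWeights hq'.2]
  have hcmb : ∀ {q q'}, IsMatching G I J q → IsMatching G I J q' →
      comb (rootPoints G) (matchWeights G I q) = comb (rootPoints G) (matchWeights G I q') :=
    fun hq hq' => by rw [comb_matchWeights hq, comb_matchWeights hq']
  -- The matching f lies in the support of w, so it is at least as heavy as p for ω + ω'; as p is
  -- maximal for both weights, f has the ω-weight of p. The matching g lies in the support of u, so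
  -- it has at least the ω-weight of f, hence the same.
  have h1 := hw.dotProduct_le (a := matchWeights G I f) (b := matchWeights G I p)
    matchWeights_nonneg (hsum hp hf) (hcmb hp hf) fun e he => hfκ e (by
      rw [hκe, he]; have := hu.1.1 e; linarith)
  have h2 := hu.dotProduct_le (a := matchWeights G I g) (b := matchWeights G I f)
    matchWeights_nonneg (hsum hf hg) (hcmb hf hg) fun e he => hgκ e (by
      rw [hκe, he]; have := hw.1.1 e; linarith)
  have h3 := ha.2 _ hfs
  have h4 := ha'.2 _ hfs
  have h5 := ha.2 _ hgs
  simp only [weight_matchVec] at h3 h4 h5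
  simp only [add_dotProduct] at h1
  obtain ⟨ε, hε, hle⟩ := exists_pos_mul_le (w := fun e => |κ e|)
    (a := matchWeights G I f + matchWeights G I g) (fun e => abs_nonneg _) (fun e he => by
      have he' : κ e = 0 := abs_eq_zero.1 he
      simp [hfκ e (by simp [he']), hgκ e (by simp [he'])])
  have hgle : ∀ e, ε * matchWeights G I g e ≤ u e := fun e => by
    by_cases hneg : κ e < 0
    · have := hle e
      rw [Pi.add_apply, hfκ e (not_lt.2 hneg.le), zero_add, abs_of_neg hneg, hκe] at this
      have := hw.1.1 e
      linarith
    · rw [hgκ e hneg, mul_zero]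
      exact hu.1.1 e
  -- ε is small enough that no coordinate of w - u changes sign, so the ℓ¹ distance drops by exactly
  -- 2ε|I|.
  set u' : G → ℝ := u + ε • (matchWeights G I f - matchWeights G I g) with hu'
  have hu'o : IsOptimal (rootPoints G) ω u' := by
    refine ⟨add_smul_sub_mem_stdSimplex hu.1 hε.le hgle matchWeights_nonneg (hsum hf hg),
      fun v hv hvc => ?_⟩
    rw [hu', dotProduct_add, dotProduct_smul, dotProduct_sub, smul_eq_mul]
    have heq : ω ⬝ᵥ matchWeights G I f - ω ⬝ᵥ matchWeights G I g = 0 := by linarith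
    rw [heq, mul_zero, add_zero]
    exact hu.2 v hv (hvc.trans (by simp [hu', hcmb hf hg]))
  have hlt := hmin u' hu'o (by simp [hu', hcmb hf hg, huc])
  have hdist : ∀ e, |w e - u' e| =
      |w e - u e| - ε * (matchWeights G I f e + matchWeights G I g e) := fun e => by
    have hle' := hle e
    have hval : w e - u' e =
        κ e - ε * (matchWeights G I f e - matchWeights G I g e) := by
      simp only [hu', hκe, Pi.add_apply, Pi.smul_apply, Pi.sub_apply, smul_eq_mul]; ring
    rw [hval, ← hκe]
    rw [Pi.add_apply] at hle'
    rcases lt_trichotomy (κ e) 0 with hneg | hzero | hpos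
    · rw [hfκ e (not_lt.2 hneg.le), abs_of_neg hneg] at hle' ⊢
      rw [abs_of_nonpos (by linarith)]
      ring
    · rw [hfκ e (by simp [hzero]), hgκ e (by simp [hzero])]
      simp
    · rw [hgκ e (not_lt.2 hpos.le), abs_of_pos hpos] at hle' ⊢
      rw [abs_of_nonneg (by linarith)]
      ring
  simp only [hdist, Finset.sum_sub_distrib, ← Finset.mul_sum, Finset.sum_add_distrib,
    sum_matchWeights hf.2, sum_matchWeights hg.2] at hlt
  have hIpos : (0 : ℝ) < I.card := by exact_mod_cast hI.card_pos
  have := mul_pos hε (add_pos hIpos hIpos)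
  linarith

theorem forall_exists_isOptimal_iff [Nonempty (Fin n)] (ω ω' : G → ℝ) :
    (∀ v ∈ stdSimplex ℝ G, ∃ w, comb (rootPoints G) w = comb (rootPoints G) v ∧
      IsOptimal (rootPoints G) ω w ∧ IsOptimal (rootPoints G) ω' w) ↔
    ∀ I J, ∀ h : I.card = J.card, minor (genericMatrix G) I J h ≠ 0 →
      ∃ a, IsMaxExponent ω (minor (genericMatrix G) I J h) a ∧
        IsMaxExponent ω' (minor (genericMatrix G) I J h) a := by
  refine ⟨fun H I J h h0 => exists_common_isMaxExponent_minor H h h0, fun H v hv => ?_⟩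
  obtain ⟨w, hw, hc⟩ := exists_isOptimal (A := rootPoints G) (ω + ω') hv
  refine ⟨w, hc, hw.left_of_add H, ?_⟩
  rw [add_comm] at hw
  exact hw.left_of_add fun I J h h0 => (H I J h h0).imp fun _ => And.symm

end RootPolytopes

theorem commonMax_minorNewtonPolytope_iff {m n : ℕ} (G : Finset (Fin m × Fin n))
    (l l' : StrongDual ℝ (G → ℝ)) :
    CommonMax (minorNewtonPolytope G) l l' ↔
      ∀ I J, ∀ h : I.card = J.card, minor (genericMatrix G) I J h ≠ 0 →
        ∃ a, IsMaxExponent (dualVec l) (minor (genericMatrix G) I J h) a ∧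
          IsMaxExponent (dualVec l') (minor (genericMatrix G) I J h) a := by
  rw [minorNewtonPolytope, commonMax_newtonPolytope_iff, minorProduct,
    exists_common_isMaxExponent_prod_iff fun p hp => (Finset.mem_filter.1 hp).2]
  simp [Subtype.forall, Prod.forall]

theorem minorProduct_ne_zero {m n : ℕ} (G : Finset (Fin m × Fin n)) : minorProduct G ≠ 0 :=
  Finset.prod_ne_zero_iff.2 fun _ hp => (Finset.mem_filter.1 hp).2

end RootPolytope

end

theorem mainTheorem8 (m n : ℕ) (hm : 1 ≤ m) (hn : 1 ≤ n) (G : Finset (Fin m × Fin n))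
    (hG : (RootPolytope.toGraph G).Connected) :
    RootPolytope.normalFan (RootPolytope.minorNewtonPolytope G) =
        RootPolytope.normalFan (RootPolytope.secondaryPolytope (RootPolytope.rootPoints G)) ∧
      RootPolytope.CombinatoriallyEquivalent (RootPolytope.minorNewtonPolytope G)
        (RootPolytope.secondaryPolytope (RootPolytope.rootPoints G)) := by
  have : Nonempty (Fin n) := ⟨⟨0, hn⟩⟩
  -- The weight 0 is a dummy: only the existence of some triangulation is needed, to make the
  -- secondary polytope nonempty.
  obtain ⟨K, hK, -⟩ := RootPolytope.exists_triangulation_isOptimalFace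
    (RootPolytope.rootPoints_injective (G := G)) 0
  refine RootPolytope.normalFan_eq_and_combinatoriallyEquivalent
    ((RootPolytope.minorProduct G).support.finite_toSet.image _)
    ((MvPolynomial.support_nonempty.2 (RootPolytope.minorProduct_ne_zero G)).to_set.image _)
    (RootPolytope.finite_gkzVectors _) ⟨_, K, hK, rfl⟩ fun l l' => ?_
  exact (RootPolytope.commonMax_minorNewtonPolytope_iff G l l').trans
    ((RootPolytope.forall_exists_isOptimal_iff _ _).symm.trans
      (RootPolytope.commonMax_secondaryPolytope_iff
        RootPolytope.rootPoints_injective l l').symm)
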